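/- **Theorem (tree-determinant expansion of the cumulants).** *Setting.* Let $\Omega$ be a finite set of single-particle states, let $\psi_a,\psi_a^\dagger$ ($a\in\Omega$) be the fermionic annihilation and creation operators on the Fock space over $\Omega$, let $h=(h_{ab})_{a,b\in\Omega}$ be a Hermitian matrix, $H_0=\sum_{a,b}h_{ab}\psi_a^\dagger\psi_b$ and $\beta\in\mathbb R$. Put $A(\tau)=e^{\tau H_0}Ae^{-\tau H_0}$, $\langle A\rangle_0=\mathrm{Tr}(Ae^{-\beta H_0})/\mathrm{Tr}(e^{-\beta H_0})$, and let $$g_\tau(a,b)=\begin{cases}\langle\psi_a(\tau)\psi_b^\dagger\rangle_0,&\tau>0,\\-\langle\psi_b^\dagger\psi_a(\tau)\rangle_0,&\tau\le 0\end{cases}$$ be the time-ordered Green's function, with the normal-ordered value at equal times. Let $s\ge1$. For $i\in[s]=\{1,\dots,s\}$ let $P_i$ consist of $P_i^+,P_i^-\in\Omega^{m_i}$, put $\Psi_{P_i}=\psi^\dagger_{P_i^+(1)}\cdots\psi^\dagger_{P_i^+(m_i)}\psi_{P_i^-(1)}\cdots\psi_{P_i^-(m_i)}$, and let $\tau_1,\dots,\tau_s\in\mathbb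 R$ be pairwise distinct. For $B\subseteq[s]$ let $\mathcal E(B)=\langle\mathcal T\prod_{i\in B}\Psi_{P_i}(\tau_i)\rangle_0$, where $\mathcal T$ orders the factors by decreasing time, and define the connected correlation $$\mathcal E_c(\{P_i,\tau_i\}_{i\in[s]})=\sum_{\Pi}(-1)^{|\Pi|-1}(|\Pi|-1)!\prod_{B\in\Pi}\mathcal E(B),$$ the sum being over all set partitions $\Pi$ of $[s]$. *Trees and contractions.* Let $\mathcal T([s])$ be the set of labeled trees on $[s]$; edges are written $(i,j)$ with $i<j$. For $T\in\mathcal T([s])$ let $\mathcal A(T)$ be the set of maps $\chi$ that assign to each edge $(i,j)$ of $T$ a triple $\chi_{ij}=(\sigma,k,l)$, $\sigma\in\{\pm1\}$, $1\le k\le m_i$, $1\le l\le m_j$, where $\chi_{ij}=(-1,k,l)$ contracts the annihilation operator $P_i^-(k)$ with the creation operator $P_j^+(l)$, and $\chi_{ij}=(+1,k,l)$ contracts $P_j^-(l)$ with $P_i^+(k)$, such that no operator is contracted more than once. Put $g_{\tau_i,\tau_j}(P_i,P_j,\chi_{ij})=g_{\tau_i-\tau_j}(P_i^-(k),P_j^+(l))$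 if $\sigma=-1$ and $g_{\tau_j-\tau_i}(P_j^-(l),P_i^+(k))$ if $\sigma=+1$. *Sign.* Give $P_i^-(k)$ the row number and $P_i^+(k)$ the column number $\sum_{r<i}m_r+k$, and let $\mathrm{inv}(\chi)$ be the number of unordered pairs of edges of $T$ whose contracted rows and contracted columns are in opposite order. Put $$\alpha_{T,\chi}=(-1)^{\mathrm{inv}(\chi)}\prod_{i=1}^s(-1)^{m_i(m_i+1)/2}\prod_{(i,j)\in T}(-1)^{\sum_{r<i}m_r+\sum_{r<j}m_r+k+l}\qquad(\chi_{ij}=(\sigma,k,l)).$$ *Growing paths and weights.* Root $T$ at $1$. Let $S(T)$ be the set of orderings $\omega(1),\dots,\omega(s)$ of $[s]$ with $\omega(1)=1$ in which the parent of each vertex precedes it. Let $X_i=\{\omega(1),\dots,\omega(i)\}$; a pair $(j,k)$ crosses $X_i$ if exactly one of $j,k$ lies in $X_i$; $b_i$ is the number of edges of $T$ that cross $X_i$. For $\mathbf t\in[0,1]^{s-1}$ put $p_{T,\omega}(\mathbf t)=\prod_{i=1}^{s-1}t_i^{b_i-1}$ and let $a(\omega,\mathbf t)_{jk}$ be the product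 of the $t_i$, $1\le i\le s-1$, for which $(j,k)$ crosses $X_i$. Let $\mathbf G(T,\chi,\omega,\mathbf t)$ be the matrix with the blocks $\big(a(\omega,\mathbf t)_{ij}\,g_{\tau_i-\tau_j}(P_i^-(k),P_j^+(l))\big)_{k\le m_i,\,l\le m_j}$, $i,j\in[s]$, from which the rows and columns of the operators contracted by $\chi$ are deleted. *Claim.* $$\mathcal E_c(\{P_i,\tau_i\}_{i\in[s]})=\sum_{T\in\mathcal T([s])}\ \sum_{\chi\in\mathcal A(T)}\alpha_{T,\chi}\prod_{(i,j)\in T}g_{\tau_i,\tau_j}(P_i,P_j,\chi_{ij})\;h_{\boldsymbol\tau}(P_1,\dots,P_s,T,\chi),$$ $$h_{\boldsymbol\tau}(P_1,\dots,P_s,T,\chi)=\sum_{\omega\in S(T)}\int_{[0,1]^{s-1}}p_{T,\omega}(\mathbf t)\,\det\mathbf G(T,\chi,\omega,\mathbf t)\,d\mathbf t.$$ -/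

import Mathlib

noncomputable section

namespace TreeDet

/-! ### The fermionic system -/

section Fock

variable {Ω : Type*} [Fintype Ω] [LinearOrder Ω]

/-- Operators on the fermionic Fock space over the finite set `Ω` of single-particle states, as
matrices in the occupation-number basis: the basis vector `S : Finset Ω` is the state in which
exactly the single-particle states of `S` are occupied. -/
abbrev FockOp (Ω : Type*) := Matrix (Finset Ω) (Finset Ω) ℂ

/-- The annihilation operator `ψ_a`: it maps the basis vector `S` to
`(-1) ^ #{b ∈ S | b < a}` times the basis vector `S \ {a}` if `a ∈ S`, and to `0` otherwise. -/
def annih (a : Ω) : FockOp Ω :=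
  Matrix.of fun S' S =>
    if a ∈ S ∧ S' = S.erase a then (-1 : ℂ) ^ (S.filter (· < a)).card else 0

/-- The creation operator `ψ_a†`, the adjoint of `ψ_a`. -/
def creat (a : Ω) : FockOp Ω := (annih a).conjTranspose

/-- The free Hamiltonian `H₀ = ∑_{a,b} h_{ab} ψ_a† ψ_b`. -/
def freeHam (h : Matrix Ω Ω ℂ) : FockOp Ω :=
  ∑ a, ∑ b, h a b • (creat a * annih b)

/-- Imaginary-time evolution `A(τ) = e^{τ H₀} A e^{-τ H₀}`. -/
def evolve (h : Matrix Ω Ω ℂ) (τ : ℝ) (A : FockOp Ω) : FockOp Ω :=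
  NormedSpace.exp ((τ : ℂ) • freeHam h) * A * NormedSpace.exp (-((τ : ℂ) • freeHam h))

/-- The free thermal expectation `⟨A⟩₀ = Tr(A e^{-β H₀}) / Tr(e^{-β H₀})`. -/
def thermal (β : ℝ) (h : Matrix Ω Ω ℂ) (A : FockOp Ω) : ℂ :=
  (A * NormedSpace.exp (-((β : ℂ) • freeHam h))).trace /
    (NormedSpace.exp (-((β : ℂ) • freeHam h)) : FockOp Ω).trace

/-- The time-ordered free Green's function: `g_τ(a,b) = ⟨ψ_a(τ) ψ_b†⟩₀` for `τ > 0` and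
`g_τ(a,b) = -⟨ψ_b† ψ_a(τ)⟩₀` for `τ ≤ 0`. At equal times it takes the normal-ordered value
(the limit `τ → 0⁻`), as the interaction terms are normally ordered. -/
def green (β : ℝ) (h : Matrix Ω Ω ℂ) (τ : ℝ) (a b : Ω) : ℂ :=
  if τ ≤ 0 then -thermal β h (creat b * evolve h τ (annih a))
  else thermal β h (evolve h τ (annih a) * creat b)

/-- A multi-index `P`: `m` creation sites `P⁺(1), …, P⁺(m)` and `m` annihilation sites
`P⁻(1), …, P⁻(m)`. -/
structure Interaction (Ω : Type*) where
  m : ℕ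
  plus : Fin m → Ω
  minus : Fin m → Ω

/-- `Ψ_P = ψ†_{P⁺(1)} ⋯ ψ†_{P⁺(m)} ψ_{P⁻(1)} ⋯ ψ_{P⁻(m)}`. -/
def Interaction.op (P : Interaction Ω) : FockOp Ω :=
  (List.ofFn fun j => creat (P.plus j)).prod * (List.ofFn fun j => annih (P.minus j)).prod

variable {s : ℕ}

/-- The indices of `B` in the order of decreasing times. -/
def timeOrder (τ : Fin s → ℝ) (B : Finset (Fin s)) : List (Fin s) :=
  (B.sort (· ≤ ·)).insertionSort fun i j => τ j ≤ τ i

/-- The time-ordered correlation `ℰ({P_i, τ_i}_{i ∈ B}) = ⟨𝒯 ∏_{i ∈ B} Ψ_{P_i}(τ_i)⟩₀`. -/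
def correlation (β : ℝ) (h : Matrix Ω Ω ℂ) (P : Fin s → Interaction Ω) (τ : Fin s → ℝ)
    (B : Finset (Fin s)) : ℂ :=
  thermal β h ((timeOrder τ B).map fun i => evolve h (τ i) (P i).op).prod

/-- The cumulant (connected correlation)
`ℰ_c = ∑_Π (-1)^{|Π|-1} (|Π|-1)! ∏_{B ∈ Π} ℰ({P_i, τ_i}_{i ∈ B})`, summed over all set partitions
`Π` of the index set. -/
def cumulant (β : ℝ) (h : Matrix Ω Ω ℂ) (P : Fin s → Interaction Ω) (τ : Fin s → ℝ) : ℂ :=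
  ∑ Q : Finpartition (Finset.univ : Finset (Fin s)),
    (-1 : ℂ) ^ (Q.parts.card - 1) * ((Q.parts.card - 1).factorial : ℂ) *
      ∏ B ∈ Q.parts, correlation β h P τ B

end Fock

/-! ### Trees, contraction assignments, signs -/

section Trees

/-- The set of labeled trees on `[s]`. -/
abbrev LabeledTree (s : ℕ) := {T : SimpleGraph (Fin s) // T.IsTree}

open scoped Classical in
instance (s : ℕ) : Fintype (LabeledTree s) := inferInstance

variable {Ω : Type*} {s : ℕ}

/-- The edges of `T`, written as pairs `(i, j)` with `i < j`. -/
abbrev Edge (T : LabeledTree s) := {e : Fin s × Fin s // e.1 < e.2 ∧ T.1.Adj e.1 e.2}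

open scoped Classical in
instance (T : LabeledTree s) : Fintype (Edge T) := inferInstance

/-- A choice of `χ_{ij} = (σ, k, l)`, with `σ = ±1`, `k ∈ [m_{P_i}]` and `l ∈ [m_{P_j}]`, for every
edge `(i, j)` of the tree. -/
abbrev PreAssignment (P : Fin s → Interaction Ω) (T : LabeledTree s) :=
  (e : Edge T) → ℤˣ × Fin (P e.1.1).m × Fin (P e.1.2).m

variable {P : Fin s → Interaction Ω} {T : LabeledTree s}

/-- The annihilation operator contracted at the edge `(i, j)`: `P_j⁻(l)` if `σ = 1` and `P_i⁻(k)` if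
`σ = -1`. -/
def annihLeg (χ : PreAssignment P T) (e : Edge T) : (i : Fin s) × Fin (P i).m :=
  if (χ e).1 = 1 then ⟨e.1.2, (χ e).2.2⟩ else ⟨e.1.1, (χ e).2.1⟩

/-- The creation operator contracted at the edge `(i, j)`: `P_i⁺(k)` if `σ = 1` and `P_j⁺(l)` if
`σ = -1`. -/
def creatLeg (χ : PreAssignment P T) (e : Edge T) : (i : Fin s) × Fin (P i).m :=
  if (χ e).1 = 1 then ⟨e.1.1, (χ e).2.1⟩ else ⟨e.1.2, (χ e).2.2⟩

/-- The set `𝒜(T)` of contraction assignments: no operator is contracted more than once. -/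
abbrev Assignment (P : Fin s → Interaction Ω) (T : LabeledTree s) :=
  {χ : PreAssignment P T // Function.Injective (annihLeg χ) ∧ Function.Injective (creatLeg χ)}

open scoped Classical in
instance : Fintype (Assignment P T) := inferInstance

/-- The position of the `k`-th operator of the `i`-th block, in the order of the blocks:
`∑_{r < i} m_{P_r} + k`. -/
def pos (P : Fin s → Interaction Ω) (x : (i : Fin s) × Fin (P i).m) : Fin (∑ i, (P i).m) :=
  finSigmaFinEquiv x

/-- The row of the Green's function matrix that is contracted at `e`. -/
def row (χ : Assignment P T) (e : Edge T) : Fin (∑ i, (P i).m) := pos P (annihLeg χ.1 e)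

/-- The column of the Green's function matrix that is contracted at `e`. -/
def col (χ : Assignment P T) (e : Edge T) : Fin (∑ i, (P i).m) := pos P (creatLeg χ.1 e)

/-- The sign `(-1)^{m(m+1)/2}` of an interaction term. -/
def interactionSign (Q : Interaction Ω) : ℤˣ := (-1) ^ (Q.m * (Q.m + 1) / 2)

/-- The sign `(-1)^{∑_{r<i} m_{P_r} + ∑_{r<j} m_{P_r} + k + l}` of `χ_{ij} = (σ, k, l)`. (The labels
`k, l` count from `0` here, which leaves the parity of `k + l` unchanged.) -/
def edgeSign (χ : Assignment P T) (e : Edge T) : ℤˣ :=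
  (-1) ^ ((∑ r ∈ Finset.Iio e.1.1, (P r).m) + (∑ r ∈ Finset.Iio e.1.2, (P r).m) +
    ((χ.1 e).2.1 : ℕ) + ((χ.1 e).2.2 : ℕ))

/-- The sign `(-1)^{inv(χ)}`, where `inv(χ)` is the number of pairs of tree edges whose contracted
rows and contracted columns are in opposite order. It is the sign of the bijection from contracted
rows to contracted columns. -/
def matchingSign (χ : Assignment P T) : ℤˣ :=
  (-1) ^ (Finset.univ.filter fun p : Edge T × Edge T =>
    row χ p.1 < row χ p.2 ∧ col χ p.2 < col χ p.1).card

/-- The sign `α_{T,χ}`. -/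
def treeSign (χ : Assignment P T) : ℤˣ :=
  (∏ i, interactionSign (P i)) * (∏ e, edgeSign χ e) * matchingSign χ

/-- The complement of the contracted rows. -/
def freeRows (χ : Assignment P T) : Finset (Fin (∑ i, (P i).m)) :=
  (Finset.univ.image (row χ))ᶜ

/-- The complement of the contracted columns. -/
def freeCols (χ : Assignment P T) : Finset (Fin (∑ i, (P i).m)) :=
  (Finset.univ.image (col χ))ᶜ

theorem card_freeCols (χ : Assignment P T) : (freeCols χ).card = (freeRows χ).card := by
  have h1 : Function.Injective (row χ) := fun a b hab =>
    χ.2.1 (finSigmaFinEquiv.injective hab)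
  have h2 : Function.Injective (col χ) := fun a b hab =>
    χ.2.2 (finSigmaFinEquiv.injective hab)
  simp only [freeCols, freeRows, Finset.card_compl, Finset.card_image_of_injective _ h1,
    Finset.card_image_of_injective _ h2]

end Trees

/-! ### Growing paths and interpolation weights

From here on the number of vertices is `s = n + 1` and the root is the least vertex `0`. -/

section Paths

variable {n : ℕ}

/-- `u` is the parent of `v` in the tree `T` rooted at `0`. -/
def IsParent (T : LabeledTree (n + 1)) (u v : Fin (n + 1)) : Prop :=
  T.1.Adj u v ∧ T.1.dist 0 v = T.1.dist 0 u + 1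

/-- The set `S(T)` of growing paths: orderings `ω(0), …, ω(n)` of the vertices that start at the root
and in which the parent of every vertex comes before the vertex. -/
abbrev GrowingPath (T : LabeledTree (n + 1)) :=
  {ω : Equiv.Perm (Fin (n + 1)) //
    ω 0 = 0 ∧ ∀ u v, IsParent T u v → ω.symm u < ω.symm v}

open scoped Classical in
instance (T : LabeledTree (n + 1)) : Fintype (GrowingPath T) := inferInstance

/-- The visited set `{ω(0), …, ω(i)}`. -/
def visited (ω : Equiv.Perm (Fin (n + 1))) (i : Fin n) : Finset (Fin (n + 1)) :=
  (Finset.Iic i.castSucc).image ω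

/-- The pair `(j, k)` crosses `X`: exactly one of `j` and `k` lies in `X`. -/
def Crosses (X : Finset (Fin (n + 1))) (j k : Fin (n + 1)) : Prop :=
  (j ∈ X ∧ k ∉ X) ∨ (k ∈ X ∧ j ∉ X)

instance (X : Finset (Fin (n + 1))) (j k : Fin (n + 1)) : Decidable (Crosses X j k) :=
  inferInstanceAs (Decidable (_ ∨ _))

/-- The number of edges of `T` that cross the visited set, which is the number of available choices
for the next vertex of the path. -/
def crossingNumber (T : LabeledTree (n + 1)) (ω : Equiv.Perm (Fin (n + 1))) (i : Fin n) : ℕ :=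
  (Finset.univ.filter fun e : Edge T => Crosses (visited ω i) e.1.1 e.1.2).card

/-- The density `p_{T,ω}(t) = ∏_i t_i^{b_i - 1}`. -/
def pathDensity (T : LabeledTree (n + 1)) (ω : Equiv.Perm (Fin (n + 1))) (t : Fin n → ℝ) : ℝ :=
  ∏ i, t i ^ (crossingNumber T ω i - 1)

/-- The weight `a(ω,t)_{jk}`, the product of the `t_i` over all `i` such that `(j, k)` crosses
`{ω(0), …, ω(i)}`. -/
def weight (ω : Equiv.Perm (Fin (n + 1))) (t : Fin n → ℝ) (j k : Fin (n + 1)) : ℝ :=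
  ∏ i with Crosses (visited ω i) j k, t i

end Paths

/-! ### Propagators and determinants -/

section Expansion

variable {Ω : Type*} [Fintype Ω] [LinearOrder Ω] {n : ℕ}

/-- The propagator `g_{τ_i,τ_j}(P_i,P_j,χ_{ij})` of the edge `(i, j)`. -/
def propagator (β : ℝ) (h : Matrix Ω Ω ℂ) {P : Fin (n + 1) → Interaction Ω} (τ : Fin (n + 1) → ℝ)
    {T : LabeledTree (n + 1)} (χ : Assignment P T) (e : Edge T) : ℂ :=
  if (χ.1 e).1 = 1 then
    green β h (τ e.1.2 - τ e.1.1) ((P e.1.2).minus (χ.1 e).2.2) ((P e.1.1).plus (χ.1 e).2.1)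
  else
    green β h (τ e.1.1 - τ e.1.2) ((P e.1.1).minus (χ.1 e).2.1) ((P e.1.2).plus (χ.1 e).2.2)

/-- The weighted Green's function matrix: the block `(i, j)` has the entries
`a(ω,t)_{ij} g_{τ_i-τ_j}(P_i⁻(k), P_j⁺(l))`, and the blocks are arranged in the order of `i` and
`j`. -/
def weightedGreen (β : ℝ) (h : Matrix Ω Ω ℂ) (P : Fin (n + 1) → Interaction Ω)
    (τ : Fin (n + 1) → ℝ) (ω : Equiv.Perm (Fin (n + 1))) (t : Fin n → ℝ) :
    Matrix (Fin (∑ i, (P i).m)) (Fin (∑ i, (P i).m)) ℂ :=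
  Matrix.of fun x y =>
    let r := finSigmaFinEquiv.symm x
    let c := finSigmaFinEquiv.symm y
    (weight ω t r.1 c.1 : ℂ) *
      green β h (τ r.1 - τ c.1) ((P r.1).minus r.2) ((P c.1).plus c.2)

/-- The submatrix `𝐆(T,χ,ω,t,{P_i,τ_i})` of the weighted Green's function matrix, obtained by deleting
the contracted rows and columns; the others keep their order. -/
def reducedGreen (β : ℝ) (h : Matrix Ω Ω ℂ) {P : Fin (n + 1) → Interaction Ω}
    (τ : Fin (n + 1) → ℝ) {T : LabeledTree (n + 1)} (χ : Assignment P T)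
    (ω : Equiv.Perm (Fin (n + 1))) (t : Fin n → ℝ) :
    Matrix (Fin (freeRows χ).card) (Fin (freeRows χ).card) ℂ :=
  (weightedGreen β h P τ ω t).submatrix
    ((freeRows χ).orderEmbOfFin rfl) ((freeCols χ).orderEmbOfFin (card_freeCols χ))

/-- The remainder
`h_τ(P_1,…,P_s,T,χ) = ∑_{ω ∈ S(T)} ∫_{[0,1]^{s-1}} p_{T,ω}(t) det 𝐆(T,χ,ω,t,{P_i,τ_i}) dt`. -/
def remainder (β : ℝ) (h : Matrix Ω Ω ℂ) {P : Fin (n + 1) → Interaction Ω} (τ : Fin (n + 1) → ℝ)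
    {T : LabeledTree (n + 1)} (χ : Assignment P T) : ℂ :=
  ∑ ω : GrowingPath T, ∫ t in Set.Icc (0 : Fin n → ℝ) 1,
    (pathDensity T ω.1 t : ℂ) * (reducedGreen β h τ χ ω.1 t).det

end Expansion

end TreeDet

end

/-!
By Wick's theorem every time-ordered correlation is, up to signs, the determinant of a diagonal
block of the matrix of Green's functions. Expanding these determinants over permutations, the
coefficients of the cumulant cancel all permutations except those whose links, from the block of
each row to the block of its column, connect the blocks.

On the other side, a Laplace expansion of `det 𝐆` writes each pair `(T, χ)` as a sum over the
permutations `σ` that extend the contractions `χ`. If `c_i` links of `σ` cross the visited set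
`{ω(0), …, ω(i)}`, the powers of `t_i` combine to `t_i^{c_i - 1}` and integrate to `1 / c_i`, the
probability of one given link when the tree grows along a uniformly chosen crossing link. Summed
over `T`, `χ` and `ω`, the coefficient of `σ` is thus the probability that the growth reaches all
blocks: `1` if the links of `σ` connect them. If they do not, no tree has contractions that `σ`
extends.
-/

noncomputable section

namespace TreeDet

/-! ### Canonical anticommutation relations -/

section CAR

variable {Ω : Type*} [LinearOrder Ω]

/-- The Jordan–Wigner sign of the state `a` in the occupation set `S`. -/
def jwSign (a : Ω) (S : Finset Ω) : ℂ := (-1) ^ (S.filter (· < a)).card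

theorem jwSign_mul_self (a : Ω) (S : Finset Ω) : jwSign a S * jwSign a S = 1 := by
  simp [jwSign, ← mul_pow]

theorem jwSign_insert {a b : Ω} {S : Finset Ω} (hb : b ∉ S) :
    jwSign a (insert b S) = (if b < a then -1 else 1) * jwSign a S := by
  rw [jwSign, jwSign, Finset.filter_insert]
  split_ifs with h
  · rw [Finset.card_insert_of_notMem (by simp [hb]), pow_succ']
  · rw [one_mul]

theorem jwSign_erase {a b : Ω} {S : Finset Ω} (hb : b ∈ S) :
    jwSign a (S.erase b) = (if b < a then -1 else 1) * jwSign a S := by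
  have h := jwSign_insert (a := a) (Finset.notMem_erase b S)
  rw [Finset.insert_erase hb] at h
  rw [h, ← mul_assoc]
  split_ifs <;> simp

theorem annih_apply (a : Ω) (S' S : Finset Ω) :
    annih a S' S = if a ∈ S ∧ S' = S.erase a then jwSign a S else 0 := rfl

theorem creat_apply (a : Ω) (S' S : Finset Ω) :
    creat a S' S = if a ∉ S ∧ S' = insert a S then jwSign a S else 0 := by
  have h : (a ∈ S' ∧ S = S'.erase a) ↔ (a ∉ S ∧ S' = insert a S) := by
    constructor <;> rintro ⟨ha, rfl⟩ <;> simp [ha]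
  rw [creat, Matrix.conjTranspose_apply, annih_apply, ite_cond_congr (propext h)]
  split_ifs with ha
  · rw [ha.2, jwSign_insert ha.1, if_neg (lt_irrefl a), one_mul]
    simp [jwSign]
  · exact star_zero ℂ

variable [Fintype Ω]

theorem mul_annih_apply (A : FockOp Ω) (b : Ω) (S' S : Finset Ω) :
    (A * annih b) S' S = if b ∈ S then A S' (S.erase b) * jwSign b S else 0 := by
  simp [Matrix.mul_apply, annih_apply, ite_and]

theorem mul_creat_apply (A : FockOp Ω) (b : Ω) (S' S : Finset Ω) :
    (A * creat b) S' S = if b ∉ S then A S' (insert b S) * jwSign b S else 0 := by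
  simp [Matrix.mul_apply, creat_apply, ite_and]

theorem annih_anticomm_annih (a b : Ω) : annih a * annih b + annih b * annih a = 0 := by
  wlog hab : a ≤ b
  · rw [add_comm, this b a (le_of_not_ge hab)]
  ext S' S
  rw [Matrix.add_apply, mul_annih_apply, mul_annih_apply, annih_apply, annih_apply]
  rcases hab.eq_or_lt with rfl | h
  · simp
  · by_cases ha : a ∈ S <;> by_cases hb : b ∈ S <;>
      simp [ha, hb, h.ne, h.ne', jwSign_erase, Finset.erase_right_comm (a := a) (b := b), h,
        h.not_gt]
    split_ifs <;> ring

theorem creat_anticomm_creat (a b : Ω) : creat a * creat b + creat b * creat a = 0 := by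
  have h := congrArg Matrix.conjTranspose (annih_anticomm_annih b a)
  simpa [Matrix.conjTranspose_add, Matrix.conjTranspose_mul, creat] using h

theorem annih_anticomm_creat (a b : Ω) :
    annih a * creat b + creat b * annih a = if a = b then 1 else 0 := by
  ext S' S
  rw [Matrix.add_apply, mul_annih_apply, mul_creat_apply, annih_apply, creat_apply]
  by_cases hab : a = b
  · subst hab
    by_cases ha : a ∈ S <;>
      simp [ha, jwSign_erase, jwSign_insert, Matrix.one_apply, jwSign_mul_self]
  · rw [if_neg hab]
    rcases lt_or_gt_of_ne hab with h | h <;> by_cases ha : a ∈ S <;> by_cases hb : b ∈ S <;>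
      simp [ha, hb, hab, Ne.symm hab, Finset.erase_insert_of_ne (Ne.symm hab), jwSign_insert,
        jwSign_erase, h, h.not_gt]
    all_goals split_ifs <;> ring

end CAR

/-! ### Invariance of subspaces under imaginary-time evolution -/

section Exponential

open NormedSpace

theorem hasSum_exp_apply {𝕜 E : Type*} [RCLike 𝕜] [NormedAddCommGroup E] [NormedSpace 𝕜 E]
    [CompleteSpace E] (B : E →L[𝕜] E) (x : E) :
    HasSum (fun k : ℕ => (k.factorial⁻¹ : 𝕜) • (B ^ k) x) (exp B x) :=
  (exp_series_hasSum_exp' (𝕂 := 𝕜) B).mapL (ContinuousLinearMap.apply 𝕜 E x)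

theorem exp_apply_mem {𝕜 E : Type*} [RCLike 𝕜] [NormedAddCommGroup E] [NormedSpace 𝕜 E]
    [CompleteSpace E] (B : E →L[𝕜] E) {W : Submodule 𝕜 E} (hclosed : IsClosed (W : Set E))
    (hW : ∀ w ∈ W, B w ∈ W) {w : E} (hw : w ∈ W) : exp B w ∈ W := by
  have hpow (k : ℕ) : (B ^ k) w ∈ W := by
    induction k with
    | zero => simpa
    | succ k ih => rw [pow_succ']; exact hW _ ih
  exact hclosed.mem_of_tendsto (hasSum_exp_apply B w) (Filter.Eventually.of_forall fun s =>
    W.sum_mem fun k _ => W.smul_mem _ (hpow k))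

variable {𝕜 A : Type*} [RCLike 𝕜] [NormedRing A] [NormedAlgebra 𝕜 A] [CompleteSpace A]

theorem exp_mul_left_apply (a x : A) : exp (ContinuousLinearMap.mul 𝕜 A a) x = exp a * x := by
  have hpow (k : ℕ) : (ContinuousLinearMap.mul 𝕜 A a ^ k) x = a ^ k * x := by
    induction k with
    | zero => simp
    | succ k ih => simp [pow_succ', ih, mul_assoc]
  refine (hasSum_exp_apply _ x).unique ?_
  simpa only [hpow, smul_mul_assoc] using (exp_series_hasSum_exp' (𝕂 := 𝕜) a).mul_right x

theorem exp_mul_right_apply (a x : A) :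
    exp ((ContinuousLinearMap.mul 𝕜 A).flip a) x = x * exp a := by
  have hpow (k : ℕ) : ((ContinuousLinearMap.mul 𝕜 A).flip a ^ k) x = x * a ^ k := by
    induction k with
    | zero => simp
    | succ k ih => rw [pow_succ', mul_apply_eq_comp, ih, pow_succ, ← mul_assoc]; rfl
  refine (hasSum_exp_apply _ x).unique ?_
  simpa only [hpow, mul_smul_comm] using (exp_series_hasSum_exp' (𝕂 := 𝕜) a).mul_left x

theorem exp_mul_mul_exp_neg_mem {H : A} {W : Submodule 𝕜 A} (hclosed : IsClosed (W : Set A))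
    (hW : ∀ w ∈ W, ⁅H, w⁆ ∈ W) {w : A} (hw : w ∈ W) : exp H * w * exp (-H) ∈ W := by
  let _ : NormedAlgebra ℚ (A →L[𝕜] A) := NormedAlgebra.restrictScalars ℚ 𝕜 _
  let L : A →L[𝕜] A := ContinuousLinearMap.mul 𝕜 A H
  let R : A →L[𝕜] A := (ContinuousLinearMap.mul 𝕜 A).flip (-H)
  have hLR : Commute L R := by ext1 x; exact (mul_assoc H x (-H)).symm
  have hexp : exp (L + R) w = exp H * w * exp (-H) := by
    rw [exp_add_of_commute hLR, mul_apply_eq_comp, exp_mul_right_apply,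
      exp_mul_left_apply, mul_assoc]
  rw [← hexp]
  refine exp_apply_mem (L + R) hclosed (fun w hw => ?_) hw
  simpa [L, R, Ring.lie_def, sub_eq_add_neg] using hW w hw

end Exponential

/-! ### Free evolution and the thermal state -/

section Thermal

open NormedSpace Submodule

theorem lie_mul_left_of_anticomm {A : Type*} [Ring A] (x y z : A) :
    ⁅x * y, z⁆ = x * (y * z + z * y) - (x * z + z * x) * y := by
  rw [Ring.lie_def]
  noncomm_ring

theorem anticomm_mem_of_mem_span {K A : Type*} [CommRing K] [Ring A] [Algebra K A] {S T : Set A}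
    {W : Submodule K A} (hST : ∀ x ∈ S, ∀ y ∈ T, x * y + y * x ∈ W) {x y : A} (hx : x ∈ span K S)
    (hy : y ∈ span K T) : x * y + y * x ∈ W :=
  LinearMap.BilinMap.apply_apply_mem_of_mem_span W S T
    (LinearMap.mul K A + (LinearMap.mul K A).flip) hST x y hx hy

section Exp

variable {m : Type*} [Fintype m] [DecidableEq m]

theorem matrix_exp_mul_exp_neg (A : Matrix m m ℂ) : exp A * exp (-A) = 1 := by
  rw [← Matrix.exp_add_of_commute _ _ (Commute.neg_right (Commute.refl A)), add_neg_cancel,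
    NormedSpace.exp_zero]

theorem matrix_exp_neg_mul_exp (A : Matrix m m ℂ) : exp (-A) * exp A = 1 := by
  simpa using matrix_exp_mul_exp_neg (-A)

open scoped Matrix.Norms.Operator in
theorem matrix_exp_mul_mul_exp_neg_mem {H : Matrix m m ℂ} {W : Submodule ℂ (Matrix m m ℂ)}
    (hW : ∀ w ∈ W, ⁅H, w⁆ ∈ W) {w : Matrix m m ℂ} (hw : w ∈ W) :
    exp H * w * exp (-H) ∈ W :=
  exp_mul_mul_exp_neg_mem W.closed_of_finiteDimensional hW hw

end Exp

attribute [local instance] LieRing.ofAssociativeRing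

variable {Ω : Type*} [Fintype Ω] [LinearOrder Ω]

theorem lie_freeHam_mem_span (h : Matrix Ω Ω ℂ) {ι : Type*} {f : ι → FockOp Ω}
    (hf : ∀ (a b : Ω) (i : ι), ⁅creat a * annih b, f i⁆ ∈ span ℂ (Set.range f)) :
    ∀ w ∈ span ℂ (Set.range f), ⁅freeHam h, w⁆ ∈ span ℂ (Set.range f) := by
  suffices span ℂ (Set.range f) ≤ (span ℂ (Set.range f)).comap (LieAlgebra.ad ℂ _ (freeHam h)) from
    fun w hw => this hw
  rw [span_le]
  rintro _ ⟨i, rfl⟩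
  simp only [SetLike.mem_coe, mem_comap, LieAlgebra.ad_apply, freeHam, sum_lie, smul_lie]
  exact sum_mem fun a _ => sum_mem fun b _ => smul_mem _ _ (hf a b i)

theorem lie_freeHam_mem_span_annih (h : Matrix Ω Ω ℂ) :
    ∀ w ∈ span ℂ (Set.range (annih (Ω := Ω))), ⁅freeHam h, w⁆ ∈ span ℂ (Set.range annih) := by
  refine lie_freeHam_mem_span h fun a b c => ?_
  rw [lie_mul_left_of_anticomm, annih_anticomm_annih, add_comm (creat a * annih c),
    annih_anticomm_creat, mul_zero, zero_sub, ite_mul, one_mul, zero_mul]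
  split_ifs
  · exact neg_mem (subset_span ⟨b, rfl⟩)
  · simp

theorem lie_freeHam_mem_span_creat (h : Matrix Ω Ω ℂ) :
    ∀ w ∈ span ℂ (Set.range (creat (Ω := Ω))), ⁅freeHam h, w⁆ ∈ span ℂ (Set.range creat) := by
  refine lie_freeHam_mem_span h fun a b c => ?_
  rw [lie_mul_left_of_anticomm, annih_anticomm_creat, creat_anticomm_creat, zero_mul, sub_zero,
    mul_ite, mul_one, mul_zero]
  split_ifs
  · exact subset_span ⟨a, rfl⟩
  · exact zero_mem _

theorem evolve_mem {h : Matrix Ω Ω ℂ} {W : Submodule ℂ (FockOp Ω)}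
    (hW : ∀ w ∈ W, ⁅freeHam h, w⁆ ∈ W) (t : ℝ) {w : FockOp Ω} (hw : w ∈ W) : evolve h t w ∈ W :=
  matrix_exp_mul_mul_exp_neg_mem
    (fun w hw => (smul_lie (t : ℂ) (freeHam h) w).symm ▸ W.smul_mem _ (hW w hw)) hw

/-- The imaginary-time evolution, as an algebra endomorphism. -/
def evolveHom (h : Matrix Ω Ω ℂ) (t : ℝ) : FockOp Ω →ₐ[ℂ] FockOp Ω :=
  AlgHom.ofLinearMap
    { toFun := evolve h t
      map_add' := fun A B => by simp only [evolve, mul_add, add_mul]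
      map_smul' := fun c A => by
        simp only [evolve, mul_smul_comm, smul_mul_assoc, RingHom.id_apply] }
    ((congrArg (· * _) (mul_one _)).trans (matrix_exp_mul_exp_neg _))
    fun A B => by
      change exp _ * (A * B) * exp (-_) = exp _ * A * exp (-_) * (exp _ * B * exp (-_))
      rw [mul_assoc _ (exp _), ← mul_assoc (exp (-_)), ← mul_assoc (exp (-_)),
        matrix_exp_neg_mul_exp]
      simp only [one_mul, mul_assoc]

theorem evolve_mul (h : Matrix Ω Ω ℂ) (t : ℝ) (A B : FockOp Ω) :
    evolve h t (A * B) = evolve h t A * evolve h t B :=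
  map_mul (evolveHom h t) A B

theorem evolve_list_prod (h : Matrix Ω Ω ℂ) (t : ℝ) (l : List (FockOp Ω)) :
    evolve h t l.prod = (l.map (evolve h t)).prod :=
  map_list_prod (evolveHom h t) l

theorem evolve_evolve (h : Matrix Ω Ω ℂ) (s t : ℝ) (A : FockOp Ω) :
    evolve h s (evolve h t A) = evolve h (s + t) A := by
  have c : Commute ((s : ℂ) • freeHam h) ((t : ℂ) • freeHam h) :=
    ((Commute.refl _).smul_left _).smul_right _
  simp only [evolve, Complex.ofReal_add, add_smul, neg_add_rev, Matrix.exp_add_of_commute _ _ c,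
    Matrix.exp_add_of_commute _ _ c.symm.neg_left.neg_right, mul_assoc]

/-- The partition function `Tr(e^{-β H₀})`, the denominator of the thermal expectation. -/
def partitionFunction (β : ℝ) (h : Matrix Ω Ω ℂ) : ℂ :=
  (exp (-((β : ℂ) • freeHam h)) : FockOp Ω).trace

theorem freeHam_isHermitian {h : Matrix Ω Ω ℂ} (hh : h.IsHermitian) :
    (freeHam h).IsHermitian := by
  simp only [Matrix.IsHermitian, freeHam, Matrix.conjTranspose_sum, Matrix.conjTranspose_smul,
    Matrix.conjTranspose_mul, creat, Matrix.conjTranspose_conjTranspose, hh.apply]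
  exact Finset.sum_comm

open scoped ComplexOrder in
theorem partitionFunction_ne_zero (β : ℝ) {h : Matrix Ω Ω ℂ} (hh : h.IsHermitian) :
    partitionFunction β h ≠ 0 := by
  let S : FockOp Ω := exp ((-(β / 2) : ℂ) • freeHam h)
  have hS : S.IsHermitian := by
    refine Matrix.IsHermitian.exp ?_
    simp [Matrix.IsHermitian, Matrix.conjTranspose_smul, (freeHam_isHermitian hh).eq]
  have hsq : exp (-((β : ℂ) • freeHam h)) = S.conjTranspose * S := by
    rw [hS.eq, ← Matrix.exp_add_of_commute _ _ (Commute.refl _), ← add_smul, ← neg_smul]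
    ring_nf
  rw [partitionFunction, hsq, Ne, Matrix.trace_conjTranspose_mul_self_eq_zero_iff]
  exact (Matrix.isUnit_exp _).ne_zero

/-- The thermal expectation, as a linear functional. -/
def thermalLin (β : ℝ) (h : Matrix Ω Ω ℂ) : FockOp Ω →ₗ[ℂ] ℂ where
  toFun := thermal β h
  map_add' A B := by simp only [thermal, add_mul, Matrix.trace_add, add_div]
  map_smul' c A := by
    simp only [thermal, smul_mul_assoc, Matrix.trace_smul, smul_eq_mul, mul_div_assoc,
      RingHom.id_apply]

theorem thermalLin_apply (β : ℝ) (h : Matrix Ω Ω ℂ) (A : FockOp Ω) :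
    thermalLin β h A = thermal β h A := rfl

theorem thermalLin_one {β : ℝ} {h : Matrix Ω Ω ℂ} (hZ : partitionFunction β h ≠ 0) :
    thermalLin β h 1 = 1 := by
  rw [thermalLin_apply, thermal, one_mul]
  exact div_self hZ

/-- The Kubo–Martin–Schwinger condition. -/
theorem thermalLin_evolve_mul (β : ℝ) (h : Matrix Ω Ω ℂ) (y A : FockOp Ω) :
    thermalLin β h (evolve h β y * A) = thermalLin β h (A * y) := by
  simp only [thermalLin_apply, thermal, evolve]
  congr 1
  set E := exp ((β : ℂ) • freeHam h)
  set R := exp (-((β : ℂ) • freeHam h)) with hR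
  calc (E * y * R * A * R).trace = (y * R * A * (R * E)).trace := by
        rw [mul_assoc, mul_assoc, mul_assoc, Matrix.trace_mul_comm]; simp only [mul_assoc]
    _ = (A * y * R).trace := by
        rw [hR, matrix_exp_neg_mul_exp, mul_one, Matrix.trace_mul_comm, mul_assoc]

theorem thermal_evolve (β : ℝ) (h : Matrix Ω Ω ℂ) (t : ℝ) (A : FockOp Ω) :
    thermal β h (evolve h t A) = thermal β h A := by
  have hcomm : Commute (-((t : ℂ) • freeHam h)) (-((β : ℂ) • freeHam h)) :=
    (((Commute.refl _).smul_left _).smul_right _).neg_left.neg_right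
  simp only [thermal, evolve]
  rw [mul_assoc, ← Matrix.exp_add_of_commute _ _ hcomm, add_comm,
    Matrix.exp_add_of_commute _ _ hcomm.symm, mul_assoc, Matrix.trace_mul_comm, mul_assoc,
    mul_assoc, matrix_exp_neg_mul_exp, mul_one]

theorem thermalLin_add_evolve_mul (β : ℝ) (h : Matrix Ω Ω ℂ) (y A : FockOp Ω) :
    thermalLin β h ((y + evolve h β y) * A) = thermalLin β h (y * A + A * y) := by
  rw [add_mul, map_add, map_add, thermalLin_evolve_mul]

-- Testing `y + evolve h β y = 0` against `g b` in the thermal state isolates the coefficient of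
-- `f b` in `y`.
theorem eq_zero_of_add_evolve_eq_zero {β : ℝ} {h : Matrix Ω Ω ℂ} (hZ : partitionFunction β h ≠ 0)
    {ι : Type*} [Finite ι] [DecidableEq ι] {f g : ι → FockOp Ω}
    (hfg : ∀ a b, f a * g b + g b * f a = if a = b then 1 else 0) {y : FockOp Ω}
    (hy : y ∈ span ℂ (Set.range f)) (hy0 : y + evolve h β y = 0) : y = 0 := by
  have := Fintype.ofFinite ι
  obtain ⟨c, rfl⟩ := (mem_span_range_iff_exists_fun ℂ).1 hy
  refine Finset.sum_eq_zero fun b _ => ?_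
  have hanti : (∑ a, c a • f a) * g b + g b * ∑ a, c a • f a = c b • 1 := by
    simp [Finset.sum_mul, Finset.mul_sum, ← Finset.sum_add_distrib, ← smul_add, hfg]
  have hcb := thermalLin_add_evolve_mul β h (∑ a, c a • f a) (g b)
  rw [hy0, zero_mul, map_zero, hanti, map_smul, thermalLin_one hZ, smul_eq_mul, mul_one] at hcb
  rw [← hcb, zero_smul]

theorem exists_add_evolve_eq {β : ℝ} {h : Matrix Ω Ω ℂ} {W : Submodule ℂ (FockOp Ω)}
    (hW : ∀ w ∈ W, ⁅freeHam h, w⁆ ∈ W) (hinj : ∀ y ∈ W, y + evolve h β y = 0 → y = 0)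
    {x : FockOp Ω} (hx : x ∈ W) : ∃ y ∈ W, y + evolve h β y = x := by
  let f : W →ₗ[ℂ] W := (LinearMap.id + (evolveHom h β).toLinearMap).restrict
    fun y hy => W.add_mem hy (evolve_mem hW β hy)
  have hf : Function.Injective f := (injective_iff_map_eq_zero f).2 fun y hy =>
    Subtype.ext (hinj y y.2 (congrArg Subtype.val hy))
  obtain ⟨y, hy⟩ := LinearMap.injective_iff_surjective.1 hf ⟨x, hx⟩
  exact ⟨y, y.2, congrArg Subtype.val hy⟩

end Thermal

/-! ### Wick's theorem -/

section QuasiFree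

variable {K A : Type*} [CommRing K] [Ring A] [Algebra K A]

theorem antiderivation_ofFn_prod_mul {D : A → A} {N : ℕ} {c : Fin (N + 1) → A}
    {d : Fin (N + 1) → K} (hD : ∀ j a, D (c j * a) = d j • a - c j * D a) (z : A) :
    D ((List.ofFn c).prod * z) =
      ∑ j : Fin (N + 1), ((-1) ^ (j : ℕ) * d j) • ((List.ofFn fun i => c (j.succAbove i)).prod * z)
        + (-1 : K) ^ (N + 1) • ((List.ofFn c).prod * D z) := by
  induction N with
  | zero => simp [hD, sub_eq_add_neg]
  | succ N ih =>
    have hsplit (j : Fin (N + 1)) : (List.ofFn fun i => c (j.succ.succAbove i)).prod =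
        c 0 * (List.ofFn fun i => c (j.succAbove i).succ).prod := by
      simp only [List.ofFn_succ, List.prod_cons, Fin.succ_succAbove_zero, Fin.succ_succAbove_succ]
    rw [List.ofFn_succ, List.prod_cons, mul_assoc, hD,
      ih (c := fun i => c i.succ) (d := fun i => d i.succ) (fun j => hD j.succ),
      Fin.sum_univ_succ (n := N + 1)]
    simp only [hsplit, mul_add, Finset.mul_sum, mul_smul_comm, Fin.succAbove_zero, Fin.val_succ,
      pow_succ, Fin.val_zero, pow_zero, one_mul, mul_neg, mul_one, neg_mul, neg_smul,
      Finset.sum_neg_distrib, neg_neg, ← mul_assoc]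
    abel

/-- `φ` is a normalised functional satisfying Wick's theorem on the fields in `F`: left
multiplication by a field `x` has, under `φ`, the effect of an anticommutator with some `y` whose
anticommutators with all fields are scalars. For a thermal state, `y` solves
`x = y + e^{β H₀} y e^{-β H₀}`, where `H₀` is the Hamiltonian. -/
structure IsQuasiFree (φ : A →ₗ[K] K) (F : Set A) : Prop where
  map_one : φ 1 = 1
  exists_anticomm : ∀ x ∈ F, ∃ y, (∀ a, φ (x * a) = φ (y * a + a * y)) ∧
    ∀ c ∈ F, y * c + c * y ∈ Submodule.span K {1}

theorem IsQuasiFree.map_mul_ofFn_prod {φ : A →ₗ[K] K} {F : Set A} (hφ : IsQuasiFree φ F) {N : ℕ}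
    (hN : Even N) {x : A} (hx : x ∈ F) {c : Fin (N + 1) → A} (hc : ∀ j, c j ∈ F) :
    φ (x * (List.ofFn c).prod) = ∑ j : Fin (N + 1),
      (-1) ^ (j : ℕ) * φ (x * c j) * φ (List.ofFn fun i => c (j.succAbove i)).prod := by
  obtain ⟨y, hy, hanti⟩ := hφ.exists_anticomm x hx
  choose d hd using fun j => Submodule.mem_span_singleton.1 (hanti (c j) (hc j))
  have hD (j : Fin (N + 1)) (a : A) : y * (c j * a) = d j • a - c j * (y * a) := by
    rw [← mul_assoc, ← mul_assoc, eq_sub_iff_add_eq, ← add_mul, ← hd, smul_one_mul]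
  have hmove := antiderivation_ofFn_prod_mul hD 1
  simp only [mul_one, hN.add_one.neg_one_pow, neg_smul, one_smul] at hmove
  simp only [hy, ← hd, map_smul, hφ.map_one, smul_eq_mul, mul_one]
  rw [hmove, neg_add_cancel_right, map_sum]
  simp only [map_smul, smul_eq_mul]

end QuasiFree

section Gaussian

open ExteriorAlgebra

variable {R X Y : Type*} [CommRing R]

/-- The antisymmetric matrix of contractions: `inl x` stands for an annihilation operator, `inr y`
for a creation operator, and `G x y` is their contraction. -/
def contractionMatrix (G : Matrix X Y R) : Matrix (X ⊕ Y) (X ⊕ Y) R :=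
  Matrix.fromBlocks 0 G (-G.transpose) 0

variable [DecidableEq X] [DecidableEq Y]

/-- The exterior product of a word of letters, each read as a basis vector. -/
def wedge (R : Type*) [CommRing R] (l : List (X ⊕ Y)) : ExteriorAlgebra R (X ⊕ Y → R) :=
  (l.map fun p => ι R (Pi.single p 1)).prod

theorem wedge_append (l l' : List (X ⊕ Y)) : wedge R (l ++ l') = wedge R l * wedge R l' := by
  simp [wedge]

theorem wedge_cons (p : X ⊕ Y) (l : List (X ⊕ Y)) :
    wedge R (p :: l) = ι R (Pi.single p 1) * wedge R l := by
  simp [wedge]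

theorem ι_single_mul_wedge (p : X ⊕ Y) (l : List (X ⊕ Y)) :
    ι R (Pi.single p 1) * wedge R l = (-1 : R) ^ l.length • (wedge R l * ι R (Pi.single p 1)) := by
  induction l with
  | nil => simp [wedge]
  | cons q l ih =>
    have hswap := ι_add_mul_swap (R := R) (Pi.single p 1 : X ⊕ Y → R) (Pi.single q 1)
    rw [wedge_cons, ← mul_assoc, eq_neg_of_add_eq_zero_left hswap, neg_mul, mul_assoc, ih]
    simp [pow_succ, mul_assoc]

theorem wedge_mul_comm (l l' : List (X ⊕ Y)) :
    wedge R l * wedge R l' = (-1 : R) ^ (l.length * l'.length) • (wedge R l' * wedge R l) := by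
  induction l with
  | nil => simp [wedge]
  | cons p l ih =>
    rw [wedge_cons, mul_assoc, ih, mul_smul_comm, ← mul_assoc, ι_single_mul_wedge, smul_mul_assoc,
      smul_smul, mul_assoc, ← pow_add, List.length_cons, add_mul, one_mul]

theorem contractLeft_wedge_ofFn (f : Module.Dual R (X ⊕ Y → R)) {N : ℕ}
    (u : Fin (N + 1) → X ⊕ Y) :
    CliffordAlgebra.contractLeft (Q := 0) f (wedge R (List.ofFn u)) =
      ∑ j : Fin (N + 1), ((-1) ^ (j : ℕ) * f (Pi.single (u j) 1)) •
        wedge R (List.ofFn fun i => u (j.succAbove i)) := by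
  have := antiderivation_ofFn_prod_mul (c := fun j => ι R (Pi.single (u j) 1))
    (fun j a => CliffordAlgebra.contractLeft_ι_mul (d := f) (Pi.single (u j) 1) a) 1
  simpa only [mul_one, CliffordAlgebra.contractLeft_one, mul_zero, smul_zero, add_zero, wedge,
    List.map_ofFn] using! this

theorem neg_one_pow_choose_two_add (m k : ℕ) :
    (-1 : R) ^ ((m + k).choose 2 + m * (m + k)) = (-1) ^ ((m + 1).choose 2 + k.choose 2) := by
  have h : (m + k).choose 2 + m * (m + k) =
      (m + 1).choose 2 + k.choose 2 + 2 * (m * k + m.choose 2) := by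
    induction m with
    | zero => simp
    | succ m ih =>
      rw [add_right_comm m 1 k]
      simp only [Nat.choose_succ_succ' _ 1, Nat.choose_one_right] at ih ⊢
      linarith
  rw [h, pow_add, pow_mul]
  simp

/-- The word of a block, which is normally ordered: creation letters come first. -/
def blockWord {I : Type*} (xs : I → List X) (i : I) : List (X ⊕ X) :=
  (xs i).map Sum.inr ++ (xs i).map Sum.inl

omit [DecidableEq X] in
theorem even_length_flatMap_blockWord {I : Type*} (xs : I → List X) (l : List I) :
    Even (l.flatMap (blockWord xs)).length := by
  induction l with
  | nil => simp
  | cons i l ih =>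
    rw [List.flatMap_cons, List.length_append, blockWord, List.length_append, List.length_map,
      List.length_map]
    exact (Even.add_self _).add ih

theorem wedge_flatMap_blockWord {I : Type*} (xs : I → List X) (l : List I) :
    (-1 : R) ^ (l.flatMap xs).length.choose 2 • wedge R (l.flatMap (blockWord xs)) =
      (l.map fun i => (-1 : R) ^ ((xs i).length + 1).choose 2).prod •
        (wedge R ((l.flatMap xs).map Sum.inl) * wedge R ((l.flatMap xs).map Sum.inr)) := by
  induction l with
  | nil => simp [wedge]
  | cons i l ih =>
    simp only [List.flatMap_cons, List.map_cons, List.map_append, List.prod_cons,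
      List.length_append]
    set m := (xs i).length
    set k := (l.flatMap xs).length
    set a := (xs i).map (Sum.inl : X → X ⊕ X) with ha
    set b := (xs i).map (Sum.inr : X → X ⊕ X) with hb
    set p := (l.flatMap xs).map (Sum.inl : X → X ⊕ X) with hp
    set q := (l.flatMap xs).map (Sum.inr : X → X ⊕ X)
    set ε := (l.map fun i => (-1 : R) ^ ((xs i).length + 1).choose 2).prod
    have hsign : (-1 : R) ^ (m + k).choose 2 =
        (-1) ^ (m + 1).choose 2 * (-1) ^ (m * (m + k)) * (-1) ^ k.choose 2 := by
      have h := congrArg (· * (-1 : R) ^ (m * (m + k))) (neg_one_pow_choose_two_add m k)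
      simp only [pow_add, mul_assoc, ← mul_pow, neg_mul_neg, one_pow, mul_one] at h
      rw [h]; ring
    have hswap : wedge R b * wedge R (a ++ p) =
        (-1 : R) ^ (m * (m + k)) • (wedge R (a ++ p) * wedge R b) := by
      rw [wedge_mul_comm, ha, hb, hp, List.length_append, List.length_map, List.length_map,
        List.length_map]
    calc (-1 : R) ^ (m + k).choose 2 • wedge R (b ++ a ++ l.flatMap (blockWord xs))
        = ((-1 : R) ^ (m + 1).choose 2 * (-1) ^ (m * (m + k))) •
            (wedge R b * (wedge R a *
              ((-1 : R) ^ k.choose 2 • wedge R (l.flatMap (blockWord xs))))) := by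
          rw [hsign, mul_smul, wedge_append, wedge_append, mul_smul_comm, mul_smul_comm, mul_assoc]
      _ = ((-1) ^ (m + 1).choose 2 * ε * (-1) ^ (m * (m + k))) •
            (wedge R b * wedge R (a ++ p) * wedge R q) := by
          simp only [ih, mul_smul_comm, smul_smul, wedge_append a, mul_right_comm, mul_assoc]
      _ = ((-1) ^ (m + 1).choose 2 * ε) • (wedge R (a ++ p) * wedge R (b ++ q)) := by
          rw [hswap, wedge_append b, smul_mul_assoc, smul_smul, mul_assoc _ _ ((-1) ^ _),
            ← mul_pow, neg_mul_neg, one_mul, one_pow, mul_one, mul_assoc]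

variable [Fintype X] [Fintype Y]

/-- The contraction as a bilinear form. -/
def contractionForm (G : Matrix X Y R) : LinearMap.BilinForm R (X ⊕ Y → R) :=
  Matrix.toBilin' (contractionMatrix G)

theorem contractionForm_single (G : Matrix X Y R) (p q : X ⊕ Y) :
    contractionForm G (Pi.single p 1) (Pi.single q 1) = contractionMatrix G p q :=
  Matrix.toBilin'_single _ p q

theorem contractionForm_self (G : Matrix X Y R) (v : X ⊕ Y → R) : contractionForm G v v = 0 := by
  rw [contractionForm, Matrix.toBilin'_apply', contractionMatrix, Matrix.fromBlocks_mulVec]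
  nth_rewrite 1 [← Sum.elim_comp_inl_inr v]
  rw [sumElim_dotProduct_sumElim]
  simp only [Matrix.zero_mulVec, zero_add, add_zero, Matrix.neg_mulVec, dotProduct_neg,
    Matrix.mulVec_transpose]
  rw [dotProduct_comm (v ∘ Sum.inr), ← Matrix.dotProduct_mulVec, add_neg_cancel]

/-- The Gaussian functional on the exterior algebra with contraction `G`: it deforms the exterior
product by the contraction form, and projects to the scalars. -/
def gaussian (G : Matrix X Y R) : ExteriorAlgebra R (X ⊕ Y → R) →ₗ[R] R :=
  algebraMapInv.toLinearMap ∘ₗ CliffordAlgebra.changeForm (B := -contractionForm G)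
    (Q := 0) (Q' := 0) (by ext v; simp [contractionForm_self])

theorem gaussian_one (G : Matrix X Y R) : gaussian G 1 = 1 := by
  rw [gaussian, LinearMap.comp_apply, CliffordAlgebra.changeForm_one]
  exact map_one algebraMapInv

theorem gaussian_ι_mul (G : Matrix X Y R) (v : X ⊕ Y → R) (x : ExteriorAlgebra R (X ⊕ Y → R)) :
    gaussian G (ι R v * x) =
      gaussian G (CliffordAlgebra.contractLeft (contractionForm G v) x) := by
  have hι : algebraMapInv (ι R v) = 0 := by simp [algebraMapInv, ι]
  rw [ι] at hι
  simp only [gaussian, LinearMap.comp_apply]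
  rw [CliffordAlgebra.changeForm_contractLeft, ι, CliffordAlgebra.changeForm_ι_mul,
    AlgHom.toLinearMap_apply, map_sub, map_mul, hι, zero_mul, zero_sub, LinearMap.neg_apply,
    map_neg, LinearMap.neg_apply, map_neg, neg_neg]
  rfl

theorem contractLeft_wedge_inl_mul (G : Matrix X Y R) (x : X) (l : List X)
    (z : ExteriorAlgebra R (X ⊕ Y → R)) :
    CliffordAlgebra.contractLeft (contractionForm G (Pi.single (Sum.inl x) 1))
      (wedge R (l.map Sum.inl) * z) = (-1 : R) ^ l.length • (wedge R (l.map Sum.inl) *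
        CliffordAlgebra.contractLeft (contractionForm G (Pi.single (Sum.inl x) 1)) z) := by
  induction l with
  | nil => simp [wedge]
  | cons y l ih =>
    rw [List.map_cons, wedge_cons, mul_assoc, ι, CliffordAlgebra.contractLeft_ι_mul, ih,
      contractionForm_single]
    simp [contractionMatrix, pow_succ, mul_assoc]

theorem gaussian_wedge_cons_ofFn (G : Matrix X Y R) {N : ℕ} (p : X ⊕ Y) (u : Fin (N + 1) → X ⊕ Y) :
    gaussian G (wedge R (p :: List.ofFn u)) =
      ∑ j : Fin (N + 1), (-1) ^ (j : ℕ) * contractionMatrix G p (u j) *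
        gaussian G (wedge R (List.ofFn fun i => u (j.succAbove i))) := by
  simp only [wedge_cons, gaussian_ι_mul, contractLeft_wedge_ofFn, contractionForm_single, map_sum,
    map_smul, smul_eq_mul]

theorem gaussian_wedge_inl_mul_wedge_inr (G : Matrix X Y R) {M : ℕ} (x : Fin M → X)
    (y : Fin M → Y) :
    gaussian G (wedge R ((List.ofFn x).map Sum.inl) * wedge R ((List.ofFn y).map Sum.inr)) =
      (-1) ^ M.choose 2 * (G.submatrix x y).det := by
  induction M with
  | zero => simp [wedge, gaussian_one]
  | succ M ih =>
    rw [List.ofFn_succ, List.map_cons, wedge_cons, mul_assoc, gaussian_ι_mul,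
      contractLeft_wedge_inl_mul, List.length_ofFn, map_smul, List.map_ofFn (f := y),
      contractLeft_wedge_ofFn, Matrix.det_succ_row_zero, Nat.choose_succ_succ',
      Nat.choose_one_right, pow_add, smul_eq_mul, mul_assoc, Finset.mul_sum, map_sum]
    congr 1
    rw [Finset.mul_sum]
    refine Finset.sum_congr rfl fun j _ => ?_
    have hminor := ih (fun i => x i.succ) (fun i => y (j.succAbove i))
    rw [List.map_ofFn (f := fun i => y (j.succAbove i))] at hminor
    rw [mul_smul_comm, map_smul, smul_eq_mul, contractionForm_single]
    exact (congrArg _ hminor).trans (mul_left_comm _ _ _)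

theorem IsQuasiFree.map_ofFn_prod {A : Type*} [Ring A] [Algebra R A] {φ : A →ₗ[R] R} {F : Set A}
    (hφ : IsQuasiFree φ F) (G : Matrix X Y R) {M N : ℕ} (hN : N = 2 * M) {c : Fin N → A}
    (hc : ∀ j, c j ∈ F) {u : Fin N → X ⊕ Y}
    (hu : ∀ i j, i < j → φ (c i * c j) = contractionMatrix G (u i) (u j)) :
    φ (List.ofFn c).prod = gaussian G (wedge R (List.ofFn u)) := by
  induction M generalizing N with
  | zero =>
    subst hN
    simp [wedge, hφ.map_one, gaussian_one]
  | succ M ih =>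
    obtain rfl : N = 2 * M + 1 + 1 := hN
    rw [List.ofFn_succ, List.prod_cons, hφ.map_mul_ofFn_prod (even_two_mul M) (hc 0)
      (fun j => hc j.succ), List.ofFn_succ, gaussian_wedge_cons_ofFn]
    refine Finset.sum_congr rfl fun j _ => ?_
    rw [hu 0 j.succ j.succ_pos, ih rfl (fun _ => hc _)
      (fun i i' hi => hu _ _ (Fin.succ_lt_succ_iff.2 (Fin.strictMono_succAbove j hi)))]

theorem IsQuasiFree.map_list_prod {A : Type*} [Ring A] [Algebra R A] {φ : A →ₗ[R] R} {F : Set A}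
    (hφ : IsQuasiFree φ F) (G : Matrix X Y R) {f : X ⊕ Y → A} (hf : ∀ p, f p ∈ F)
    {l : List (X ⊕ Y)} (hl : Even l.length)
    (hp : l.Pairwise fun p q => φ (f p * f q) = contractionMatrix G p q) :
    φ (l.map f).prod = gaussian G (wedge R l) := by
  obtain ⟨M, hM⟩ := hl
  have h := hφ.map_ofFn_prod G (hM.trans (two_mul M).symm) (c := f ∘ l.get) (fun _ => hf _)
    (List.pairwise_iff_get.1 hp)
  rwa [← List.map_ofFn, List.ofFn_get] at h

theorem gaussian_wedge_blockWord {I : Type*} (G : Matrix X X R) (xs : I → List X) (l : List I) :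
    gaussian G (wedge R (l.flatMap (blockWord xs))) =
      (l.map fun i => (-1 : R) ^ ((xs i).length + 1).choose 2).prod *
        (G.submatrix (l.flatMap xs).get (l.flatMap xs).get).det := by
  have hdet := gaussian_wedge_inl_mul_wedge_inr G (l.flatMap xs).get (l.flatMap xs).get
  have hword := congrArg (gaussian G) (wedge_flatMap_blockWord (R := R) xs l)
  rw [List.ofFn_get] at hdet
  rw [map_smul (gaussian G), map_smul (gaussian G), hdet, smul_eq_mul, smul_eq_mul,
    mul_left_comm] at hword
  exact (isUnit_one.neg.pow _).mul_left_cancel hword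

end Gaussian

section ThermalQuasiFree

open Submodule

variable {Ω : Type*} [Fintype Ω] [LinearOrder Ω]

variable (Ω) in
/-- The fields: the linear combinations of annihilation operators, and those of creation
operators. -/
def fermiFields : Set (FockOp Ω) :=
  {x | x ∈ span ℂ (Set.range annih) ∨ x ∈ span ℂ (Set.range creat)}

theorem evolve_mem_fermiFields (h : Matrix Ω Ω ℂ) (t : ℝ) {x : FockOp Ω}
    (hx : x ∈ fermiFields Ω) : evolve h t x ∈ fermiFields Ω :=
  hx.imp (evolve_mem (lie_freeHam_mem_span_annih h) t) (evolve_mem (lie_freeHam_mem_span_creat h) t)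

theorem anticomm_annih_eq_zero {x y : FockOp Ω} (hx : x ∈ span ℂ (Set.range annih))
    (hy : y ∈ span ℂ (Set.range annih)) : x * y + y * x = 0 := by
  refine (mem_bot ℂ).1 (anticomm_mem_of_mem_span ?_ hx hy)
  rintro _ ⟨a, rfl⟩ _ ⟨b, rfl⟩
  exact annih_anticomm_annih a b

theorem anticomm_creat_eq_zero {x y : FockOp Ω} (hx : x ∈ span ℂ (Set.range creat))
    (hy : y ∈ span ℂ (Set.range creat)) : x * y + y * x = 0 := by
  refine (mem_bot ℂ).1 (anticomm_mem_of_mem_span ?_ hx hy)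
  rintro _ ⟨a, rfl⟩ _ ⟨b, rfl⟩
  exact creat_anticomm_creat a b

theorem anticomm_annih_creat_mem {x y : FockOp Ω} (hx : x ∈ span ℂ (Set.range annih))
    (hy : y ∈ span ℂ (Set.range creat)) : x * y + y * x ∈ span ℂ {1} := by
  refine anticomm_mem_of_mem_span ?_ hx hy
  rintro _ ⟨a, rfl⟩ _ ⟨b, rfl⟩
  rw [annih_anticomm_creat]
  split_ifs
  exacts [mem_span_singleton_self 1, zero_mem _]

variable {β : ℝ} {h : Matrix Ω Ω ℂ} (hZ : partitionFunction β h ≠ 0)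
include hZ

theorem exists_add_evolve_eq_annih {x : FockOp Ω} (hx : x ∈ span ℂ (Set.range annih)) :
    ∃ y ∈ span ℂ (Set.range annih), y + evolve h β y = x :=
  exists_add_evolve_eq (lie_freeHam_mem_span_annih h)
    (fun _ => eq_zero_of_add_evolve_eq_zero hZ annih_anticomm_creat) hx

theorem exists_add_evolve_eq_creat {x : FockOp Ω} (hx : x ∈ span ℂ (Set.range creat)) :
    ∃ y ∈ span ℂ (Set.range creat), y + evolve h β y = x := by
  refine exists_add_evolve_eq (lie_freeHam_mem_span_creat h)
    (fun _ => eq_zero_of_add_evolve_eq_zero hZ (g := annih) fun a b => ?_) hx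
  rw [add_comm, annih_anticomm_creat]
  exact if_congr eq_comm rfl rfl

theorem thermal_annih_mul_annih {x y : FockOp Ω} (hx : x ∈ span ℂ (Set.range annih))
    (hy : y ∈ span ℂ (Set.range annih)) : thermal β h (x * y) = 0 := by
  obtain ⟨z, hz, rfl⟩ := exists_add_evolve_eq_annih hZ hx
  rw [← thermalLin_apply, thermalLin_add_evolve_mul, anticomm_annih_eq_zero hz hy, map_zero]

theorem thermal_creat_mul_creat {x y : FockOp Ω} (hx : x ∈ span ℂ (Set.range creat))
    (hy : y ∈ span ℂ (Set.range creat)) : thermal β h (x * y) = 0 := by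
  obtain ⟨z, hz, rfl⟩ := exists_add_evolve_eq_creat hZ hx
  rw [← thermalLin_apply, thermalLin_add_evolve_mul, anticomm_creat_eq_zero hz hy, map_zero]

theorem thermalLin_isQuasiFree : IsQuasiFree (thermalLin β h) (fermiFields Ω) where
  map_one := thermalLin_one hZ
  exists_anticomm := by
    rintro _ (hx | hx)
    · obtain ⟨y, hy, rfl⟩ := exists_add_evolve_eq_annih hZ hx
      refine ⟨y, thermalLin_add_evolve_mul β h y, ?_⟩
      rintro c (hc | hc)
      · exact anticomm_annih_eq_zero hy hc ▸ zero_mem _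
      · exact anticomm_annih_creat_mem hy hc
    · obtain ⟨y, hy, rfl⟩ := exists_add_evolve_eq_creat hZ hx
      refine ⟨y, thermalLin_add_evolve_mul β h y, ?_⟩
      rintro c (hc | hc)
      · exact add_comm (c * y) _ ▸ anticomm_annih_creat_mem hc hy
      · exact anticomm_creat_eq_zero hy hc ▸ zero_mem _

end ThermalQuasiFree

section TimeOrder

variable {s : ℕ}

theorem timeOrder_perm (τ : Fin s → ℝ) (B : Finset (Fin s)) :
    (timeOrder τ B).Perm (B.sort (· ≤ ·)) :=
  List.perm_insertionSort _ _

theorem timeOrder_nodup (τ : Fin s → ℝ) (B : Finset (Fin s)) : (timeOrder τ B).Nodup :=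
  (timeOrder_perm τ B).nodup_iff.2 (B.sort_nodup _)

theorem mem_timeOrder {τ : Fin s → ℝ} {B : Finset (Fin s)} {i : Fin s} :
    i ∈ timeOrder τ B ↔ i ∈ B := by
  rw [(timeOrder_perm τ B).mem_iff, Finset.mem_sort]

theorem prod_map_timeOrder {M : Type*} [CommMonoid M] (τ : Fin s → ℝ) (B : Finset (Fin s))
    (f : Fin s → M) : ((timeOrder τ B).map f).prod = ∏ i ∈ B, f i := by
  rw [((timeOrder_perm τ B).map f).prod_eq, ← List.prod_toFinset _ (B.sort_nodup _),
    Finset.sort_toFinset]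

theorem timeOrder_pairwise {τ : Fin s → ℝ} (hτ : Function.Injective τ) (B : Finset (Fin s)) :
    (timeOrder τ B).Pairwise fun i j => τ j < τ i := by
  have : Std.Total (fun i j : Fin s => τ j ≤ τ i) := ⟨fun i j => le_total _ _⟩
  have : IsTrans (Fin s) (fun i j : Fin s => τ j ≤ τ i) := ⟨fun i j k hij hjk => hjk.trans hij⟩
  have hsorted : (timeOrder τ B).Pairwise fun i j => τ j ≤ τ i := List.pairwise_insertionSort _ _
  exact (hsorted.and (timeOrder_nodup τ B)).imp fun hij =>
    lt_of_le_of_ne hij.1 fun he => hij.2 (hτ he).symm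

end TimeOrder

section Correlation

variable {Ω : Type*} {s : ℕ}

/-- The index `(i, k)` of the `k`-th annihilation or creation operator of the `i`-th interaction
term. -/
abbrev Leg (P : Fin s → Interaction Ω) := (i : Fin s) × Fin (P i).m

/-- The legs of the `i`-th interaction term, in their order in the term. -/
def legs (P : Fin s → Interaction Ω) (i : Fin s) : List (Leg P) :=
  List.ofFn fun k => ⟨i, k⟩

theorem mem_legs {P : Fin s → Interaction Ω} {i : Fin s} {x : Leg P} :
    x ∈ legs P i ↔ x.1 = i := by
  rw [legs, List.mem_ofFn]
  constructor
  · rintro ⟨k, rfl⟩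
    rfl
  · rintro rfl
    exact ⟨x.2, rfl⟩

/-- The letter `q` may stand to the right of the letter `p` in a time-ordered word. At equal times,
creation operators stand to the left. -/
def TimeOrdered {P : Fin s → Interaction Ω} (τ : Fin s → ℝ) : Leg P ⊕ Leg P → Leg P ⊕ Leg P → Prop
  | Sum.inl x, Sum.inr y => τ y.1 < τ x.1
  | Sum.inr y, Sum.inl x => τ x.1 ≤ τ y.1
  | _, _ => True

theorem blockWord_legs_pairwise (P : Fin s → Interaction Ω) (τ : Fin s → ℝ) (i : Fin s) :
    (blockWord (legs P) i).Pairwise (TimeOrdered τ) := by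
  simp only [blockWord, List.pairwise_append, List.pairwise_map, List.mem_map]
  refine ⟨List.pairwise_of_forall fun _ _ => trivial,
    List.pairwise_of_forall fun _ _ => trivial, ?_⟩
  rintro _ ⟨x, hx, rfl⟩ _ ⟨y, hy, rfl⟩
  exact (congrArg τ ((mem_legs.1 hy).trans (mem_legs.1 hx).symm)).le

theorem flatMap_blockWord_legs_pairwise (P : Fin s → Interaction Ω) {τ : Fin s → ℝ}
    (hτ : Function.Injective τ) (B : Finset (Fin s)) :
    ((timeOrder τ B).flatMap (blockWord (legs P))).Pairwise (TimeOrdered τ) := by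
  refine List.pairwise_flatMap.2 ⟨fun i _ => blockWord_legs_pairwise P τ i,
    (timeOrder_pairwise hτ B).imp fun {i j} hij p hp q hq => ?_⟩
  simp only [blockWord, List.mem_append, List.mem_map] at hp hq
  rcases hp with ⟨x, hx, rfl⟩ | ⟨x, hx, rfl⟩ <;> rcases hq with ⟨y, hy, rfl⟩ | ⟨y, hy, rfl⟩ <;>
    rw [mem_legs] at hx hy <;> simp [TimeOrdered, hx, hy, hij, hij.le]

variable [Fintype Ω] [LinearOrder Ω]

/-- The matrix of the Green's functions between all annihilation and all creation operators. -/
def greenMatrix (β : ℝ) (h : Matrix Ω Ω ℂ) (P : Fin s → Interaction Ω) (τ : Fin s → ℝ) :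
    Matrix (Leg P) (Leg P) ℂ :=
  Matrix.of fun r c => green β h (τ r.1 - τ c.1) ((P r.1).minus r.2) ((P c.1).plus c.2)

/-- The time-evolved annihilation or creation operator that a letter stands for. -/
def field (h : Matrix Ω Ω ℂ) (P : Fin s → Interaction Ω) (τ : Fin s → ℝ) : Leg P ⊕ Leg P → FockOp Ω
  | Sum.inl x => evolve h (τ x.1) (annih ((P x.1).minus x.2))
  | Sum.inr x => evolve h (τ x.1) (creat ((P x.1).plus x.2))

theorem field_mem_fermiFields (h : Matrix Ω Ω ℂ) (P : Fin s → Interaction Ω) (τ : Fin s → ℝ)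
    (p : Leg P ⊕ Leg P) : field h P τ p ∈ fermiFields Ω := by
  rcases p with x | x
  · exact evolve_mem_fermiFields h _ (Or.inl (Submodule.subset_span (Set.mem_range_self _)))
  · exact evolve_mem_fermiFields h _ (Or.inr (Submodule.subset_span (Set.mem_range_self _)))

theorem thermal_evolve_mul_evolve_left (β : ℝ) (h : Matrix Ω Ω ℂ) (t u : ℝ) (A B : FockOp Ω) :
    thermal β h (evolve h t A * evolve h u B) = thermal β h (evolve h (t - u) A * B) := by
  rw [← thermal_evolve β h u (evolve h (t - u) A * B), evolve_mul,
    evolve_evolve, add_sub_cancel]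

theorem thermal_evolve_mul_evolve_right (β : ℝ) (h : Matrix Ω Ω ℂ) (t u : ℝ) (A B : FockOp Ω) :
    thermal β h (evolve h t A * evolve h u B) = thermal β h (A * evolve h (u - t) B) := by
  rw [← thermal_evolve β h t (A * evolve h (u - t) B), evolve_mul,
    evolve_evolve, add_sub_cancel]

theorem evolve_op (h : Matrix Ω Ω ℂ) (P : Fin s → Interaction Ω) (τ : Fin s → ℝ) (i : Fin s) :
    evolve h (τ i) (P i).op = ((blockWord (legs P) i).map (field h P τ)).prod := by
  rw [Interaction.op, evolve_mul, evolve_list_prod, evolve_list_prod, blockWord,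
    List.map_append, List.prod_append]
  simp only [List.map_ofFn, legs]
  rfl

variable {β : ℝ} {h : Matrix Ω Ω ℂ} (hZ : partitionFunction β h ≠ 0) (P : Fin s → Interaction Ω)
  {τ : Fin s → ℝ}
include hZ

theorem thermal_field_mul_field {p q : Leg P ⊕ Leg P} (hpq : TimeOrdered τ p q) :
    thermal β h (field h P τ p * field h P τ q) =
      contractionMatrix (greenMatrix β h P τ) p q := by
  rcases p with x | x <;> rcases q with y | y
  · exact thermal_annih_mul_annih hZ
      (evolve_mem (lie_freeHam_mem_span_annih h) _ (Submodule.subset_span ⟨_, rfl⟩))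
      (evolve_mem (lie_freeHam_mem_span_annih h) _ (Submodule.subset_span ⟨_, rfl⟩))
  · have hxy : ¬τ x.1 - τ y.1 ≤ 0 := not_le.2 (sub_pos.2 hpq)
    simp only [field, thermal_evolve_mul_evolve_left, contractionMatrix,
      Matrix.fromBlocks_apply₁₂, greenMatrix, Matrix.of_apply, green, if_neg hxy]
  · have hyx : τ y.1 - τ x.1 ≤ 0 := sub_nonpos.2 hpq
    simp only [field, thermal_evolve_mul_evolve_right, contractionMatrix,
      Matrix.fromBlocks_apply₂₁, greenMatrix, Matrix.neg_apply, Matrix.transpose_apply,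
      Matrix.of_apply, green, if_pos hyx, neg_neg]
  · exact thermal_creat_mul_creat hZ
      (evolve_mem (lie_freeHam_mem_span_creat h) _ (Submodule.subset_span ⟨_, rfl⟩))
      (evolve_mem (lie_freeHam_mem_span_creat h) _ (Submodule.subset_span ⟨_, rfl⟩))

theorem correlation_eq_gaussian (hτ : Function.Injective τ) (B : Finset (Fin s)) :
    correlation β h P τ B = gaussian (greenMatrix β h P τ)
      (wedge ℂ ((timeOrder τ B).flatMap (blockWord (legs P)))) := by
  have hword : ((timeOrder τ B).map fun i => evolve h (τ i) (P i).op).prod =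
      (((timeOrder τ B).flatMap (blockWord (legs P))).map (field h P τ)).prod := by
    rw [List.map_flatMap, List.flatMap, List.prod_flatten, List.map_map]
    exact congrArg List.prod (List.map_congr_left fun i _ => evolve_op h P τ i)
  rw [correlation, hword]
  exact (thermalLin_isQuasiFree hZ).map_list_prod (greenMatrix β h P τ)
    (field_mem_fermiFields h P τ) (even_length_flatMap_blockWord _ _)
    ((flatMap_blockWord_legs_pairwise P hτ B).imp (thermal_field_mul_field hZ P))

omit [Fintype Ω] [LinearOrder Ω] hZ in
theorem nodup_flatMap_legs (τ : Fin s → ℝ) (B : Finset (Fin s)) :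
    ((timeOrder τ B).flatMap (legs P)).Nodup := by
  refine List.nodup_flatMap.2 ⟨fun i _ => List.nodup_ofFn.2 fun _ _ hkl =>
      eq_of_heq (Sigma.mk.inj hkl).2,
    List.Pairwise.imp (fun {i j} hij x hx hy => ?_) (timeOrder_nodup τ B)⟩
  exact hij ((mem_legs.1 hx).symm.trans (mem_legs.1 hy))

theorem correlation_eq_det (hτ : Function.Injective τ) (B : Finset (Fin s)) :
    correlation β h P τ B = (∏ i ∈ B, ((interactionSign (P i) : ℤ) : ℂ)) *
      ((greenMatrix β h P τ).submatrix
        (Subtype.val : {x : Leg P // x.1 ∈ B} → Leg P) Subtype.val).det := by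
  have hmem (x : Leg P) : x ∈ (timeOrder τ B).flatMap (legs P) ↔ x.1 ∈ B := by
    simp [List.mem_flatMap, mem_legs, mem_timeOrder]
  let e := ((nodup_flatMap_legs P τ B).getEquiv _).trans (Equiv.subtypeEquivRight hmem)
  rw [correlation_eq_gaussian hZ P hτ, gaussian_wedge_blockWord, prod_map_timeOrder,
    ← Matrix.det_submatrix_equiv_self e, Matrix.submatrix_submatrix]
  congr 1
  refine Finset.prod_congr rfl fun i _ => ?_
  simp [interactionSign, legs, Nat.choose_two_right, mul_comm]

end Correlation

/-! ### Cumulants and connected graphs -/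

section Partitions

open Finset Polynomial

variable {V : Type*} [Fintype V] [DecidableEq V]

theorem part_eq_part_iff (Q : Finpartition (univ : Finset V)) (v w : V) :
    Q.part v = Q.part w ↔ v ∈ Q.part w := by
  rw [Q.mem_part_iff_part_eq_part (mem_univ _) (mem_univ _)]

theorem parts_eq_image_part (Q : Finpartition (univ : Finset V)) :
    Q.parts = univ.image Q.part := by
  ext B
  simp only [mem_image, mem_univ, true_and]
  constructor
  · intro hB
    obtain ⟨v, hv⟩ := Q.nonempty_of_mem_parts hB
    exact ⟨v, Q.part_eq_of_mem hB hv⟩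
  · rintro ⟨v, rfl⟩
    exact Q.part_mem.2 (mem_univ v)

open scoped Classical in
/-- The partition into the fibres of `f`. -/
def fiberPartition {α : Type*} (f : V → α) : Finpartition (univ : Finset V) :=
  Finpartition.ofSetoid (Setoid.ker f)

theorem fiberPartition_eq_iff {α : Type*} {f : V → α} {Q : Finpartition (univ : Finset V)} :
    fiberPartition f = Q ↔ ∀ v w, f v = f w ↔ Q.part v = Q.part w := by
  classical
  have hpart (v w : V) : v ∈ (fiberPartition f).part w ↔ f v = f w := by
    rw [fiberPartition, Finpartition.mem_part_ofSetoid_iff_rel, Setoid.ker_def, eq_comm]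
  constructor
  · rintro rfl v w
    rw [part_eq_part_iff, hpart]
  · intro hQ
    have hfQ : (fiberPartition f).part = Q.part := by
      ext w v
      rw [hpart, hQ, part_eq_part_iff]
    ext1
    rw [parts_eq_image_part, parts_eq_image_part, hfQ]

theorem card_fiberPartition_eq (Q : Finpartition (univ : Finset V)) (q : ℕ) :
    Nat.card {f : V → Fin q // fiberPartition f = Q} = q.descFactorial #Q.parts := by
  choose r hr using fun B : Q.parts => Q.nonempty_of_mem_parts B.2
  have hpart (B : Q.parts) : Q.part (r B) = B.1 := Q.part_eq_of_mem B.2 (hr B)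
  let e : {f : V → Fin q // fiberPartition f = Q} ≃ (Q.parts ↪ Fin q) :=
    { toFun := fun f => ⟨fun B => f.1 (r B), fun B C hBC => Subtype.ext <| by
        rw [← hpart B, ← hpart C]
        exact (fiberPartition_eq_iff.1 f.2 _ _).1 hBC⟩
      invFun := fun g => ⟨fun v => g ⟨Q.part v, Q.part_mem.2 (mem_univ v)⟩,
        fiberPartition_eq_iff.2 fun v w => by rw [g.injective.eq_iff, Subtype.mk.injEq]⟩
      left_inv := fun f => Subtype.ext <| funext fun v =>
        (fiberPartition_eq_iff.1 f.2 _ _).2 (hpart _)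
      right_inv := fun g => by
        ext B
        simp [hpart] }
  rw [Nat.card_congr e, Nat.card_eq_fintype_card, Fintype.card_embedding_eq, Fintype.card_fin,
    Fintype.card_coe]

theorem descPochhammer_coeff_one {R : Type*} [CommRing R] (k : ℕ) :
    (descPochhammer R (k + 1)).coeff 1 = (-1) ^ k * (k.factorial : R) := by
  have hasc := ascPochhammer_eval_neg_eq_descPochhammer R (-1) k
  rw [neg_neg, ascPochhammer_eval_one] at hasc
  rw [descPochhammer_succ_left, coeff_X_mul (n := 0), coeff_zero_eq_eval_zero, eval_comp,
    eval_sub, eval_X, eval_one, zero_sub, hasc, ← mul_assoc, ← mul_pow, neg_mul_neg, one_mul,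
    one_pow, one_mul]

/-- The partition `Q` does not separate adjacent vertices of `H`. -/
def Respects (H : SimpleGraph V) (Q : Finpartition (univ : Finset V)) : Prop :=
  ∀ v w, H.Adj v w → Q.part v = Q.part w

omit [Fintype V] [DecidableEq V] in
theorem card_constant_on_components [Finite V] (H : SimpleGraph V) (q : ℕ) :
    Nat.card {f : V → Fin q // ∀ v w, H.Adj v w → f v = f w} =
      q ^ Nat.card H.ConnectedComponent := by
  have hreach (f : V → Fin q) (hf : ∀ v w, H.Adj v w → f v = f w) (v w : V) :
      H.Reachable v w → f v = f w := by
    rintro ⟨p⟩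
    induction p with
    | nil => rfl
    | cons hadj _ ih => exact (hf _ _ hadj).trans ih
  let e : {f : V → Fin q // ∀ v w, H.Adj v w → f v = f w} ≃ (H.ConnectedComponent → Fin q) :=
    { toFun := fun f => Quot.lift f.1 (hreach f.1 f.2)
      invFun := fun g => ⟨fun v => g (H.connectedComponentMk v), fun v w hvw =>
        congrArg g (SimpleGraph.ConnectedComponent.sound hvw.reachable)⟩
      left_inv := fun f => rfl
      right_inv := fun g => by
        funext c
        induction c using SimpleGraph.ConnectedComponent.ind
        rfl }
  rw [Nat.card_congr e, Nat.card_fun, Nat.card_eq_fintype_card, Fintype.card_fin]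

open scoped Classical in
theorem card_eq_sum_respects (H : SimpleGraph V) (q : ℕ) :
    Nat.card {f : V → Fin q // ∀ v w, H.Adj v w → f v = f w} =
      ∑ Q : Finpartition (univ : Finset V) with Respects H Q, q.descFactorial #Q.parts := by
  simp only [← card_fiberPartition_eq, Nat.card_eq_fintype_card, Fintype.card_subtype]
  rw [card_eq_sum_card_fiberwise (f := fiberPartition) (t := {Q | Respects H Q})]
  · refine sum_congr rfl fun Q hQ => congrArg card ?_
    ext f
    simp only [mem_filter, mem_univ, true_and, and_iff_right_iff_imp]
    rintro rfl v w hvw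
    exact (fiberPartition_eq_iff.1 rfl v w).2 ((mem_filter_univ _).1 hQ v w hvw)
  · intro f hf
    simp only [coe_filter, mem_univ, true_and, Set.mem_ofPred_eq] at hf ⊢
    exact fun v w hvw => (fiberPartition_eq_iff.1 rfl v w).1 (hf v w hvw)

open scoped Classical in
theorem sum_respects_descPochhammer (H : SimpleGraph V) :
    ∑ Q : Finpartition (univ : Finset V) with Respects H Q, descPochhammer ℤ #Q.parts =
      X ^ Nat.card H.ConnectedComponent := by
  refine Polynomial.eq_of_infinite_eval_eq _ _ (Set.Infinite.mono ?_
    (Set.infinite_range_of_injective (Nat.cast_injective (R := ℤ))))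
  rintro _ ⟨q, rfl⟩
  simp only [Set.mem_ofPred_eq, eval_finsetSum, eval_pow, eval_X,
    descPochhammer_eval_eq_descFactorial]
  exact_mod_cast (card_eq_sum_respects H q).symm.trans (card_constant_on_components H q)

omit [Fintype V] [DecidableEq V] in
theorem card_connectedComponent_eq_one_iff [Nonempty V] (H : SimpleGraph V) :
    Nat.card H.ConnectedComponent = 1 ↔ H.Connected := by
  rw [Nat.card_eq_one_iff_unique]
  constructor
  · rintro ⟨hsub, -⟩
    exact ⟨fun v w => SimpleGraph.ConnectedComponent.exact (Subsingleton.elim _ _)⟩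
  · exact fun hH => ⟨hH.preconnected.subsingleton_connectedComponent,
      ⟨H.connectedComponentMk (Classical.arbitrary V)⟩⟩

open scoped Classical in
theorem sum_respects_eq_ite_connected {R : Type*} [CommRing R] [Nonempty V] (H : SimpleGraph V) :
    ∑ Q : Finpartition (univ : Finset V) with Respects H Q,
      (-1 : R) ^ (#Q.parts - 1) * ((#Q.parts - 1).factorial : R) =
        if H.Connected then 1 else 0 := by
  have hcoeff := congrArg (fun p : ℤ[X] => ((p.coeff 1 : ℤ) : R)) (sum_respects_descPochhammer H)
  simp only [finsetSum_coeff, coeff_X_pow, eq_comm (a := 1),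
    card_connectedComponent_eq_one_iff] at hcoeff
  rw [← Int.cast_one, ← Int.cast_zero, ← Int.cast_ite, ← hcoeff, Int.cast_sum]
  refine sum_congr rfl fun Q _ => ?_
  have hQ : 0 < #Q.parts := card_pos.2 (Q.parts_nonempty univ_nonempty.ne_empty)
  rw [← Nat.sub_add_cancel hQ, descPochhammer_coeff_one]
  simp

end Partitions

section BlockDet

open Finset

variable {R X V : Type*} [CommRing R] [Fintype X] [DecidableEq X]

theorem det_eq_sum_sign_mul_prod_row (M : Matrix X X R) :
    M.det = ∑ σ : Equiv.Perm X, ((Equiv.Perm.sign σ : ℤ) : R) * ∏ x, M x (σ x) := by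
  rw [← Matrix.det_transpose, Matrix.det_apply']
  rfl

theorem det_of_ite_eq {I : Type*} [Fintype I] [DecidableEq I] (b : X → I) (G : Matrix X X R) :
    (Matrix.of fun x y => if b x = b y then G x y else 0).det =
      ∏ i, (G.submatrix (Subtype.val : {x // b x = i} → X) Subtype.val).det := by
  let : LinearOrder I := LinearOrder.lift' (Fintype.equivFin I) (Equiv.injective _)
  have htri : (Matrix.of fun x y => if b x = b y then G x y else 0).BlockTriangular b :=
    fun x y hxy => if_neg hxy.ne'
  rw [htri.det_fintype]
  refine prod_congr rfl fun i _ => congrArg Matrix.det ?_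
  ext x y
  exact if_pos (x.2.trans y.2.symm)

variable [Fintype V] [DecidableEq V]

open scoped Classical in
theorem prod_det_blocks (blk : X → V) (G : Matrix X X R) (Q : Finpartition (univ : Finset V)) :
    ∏ B ∈ Q.parts, (G.submatrix (Subtype.val : {x // blk x ∈ B} → X) Subtype.val).det =
      ∑ σ : Equiv.Perm X with ∀ x, Q.part (blk x) = Q.part (blk (σ x)),
        ((Equiv.Perm.sign σ : ℤ) : R) * ∏ x, G x (σ x) := by
  let b (x : X) : Q.parts := ⟨Q.part (blk x), Q.part_mem.2 (mem_univ _)⟩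
  have hb (B : Q.parts) (x : X) : blk x ∈ B.1 ↔ b x = B :=
    (Q.part_eq_iff_mem B.2).symm.trans (Subtype.ext_iff (a1 := b x)).symm
  have hblock (B : Q.parts) :
      (G.submatrix (Subtype.val : {x // blk x ∈ B.1} → X) Subtype.val).det =
        (G.submatrix (Subtype.val : {x // b x = B} → X) Subtype.val).det :=
    Matrix.det_submatrix_equiv_self (Equiv.subtypeEquivRight (hb B))
      (G.submatrix (Subtype.val : {x // b x = B} → X) Subtype.val)
  rw [← prod_coe_sort, prod_congr rfl fun B _ => hblock B, ← det_of_ite_eq,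
    det_eq_sum_sign_mul_prod_row, sum_filter]
  refine sum_congr rfl fun σ _ => ?_
  simp only [Matrix.of_apply, b, Subtype.mk.injEq, prod_ite_zero, mem_univ, true_imp_iff,
    mul_ite, mul_zero]

/-- The graph whose edges are the pairs of distinct blocks linked by the permutation `σ`. -/
def linkGraph {X V : Type*} (blk : X → V) (σ : Equiv.Perm X) : SimpleGraph V :=
  SimpleGraph.fromEdgeSet (Set.range fun x => s(blk x, blk (σ x)))

omit [Fintype X] [DecidableEq X] in
theorem respects_linkGraph (blk : X → V) (σ : Equiv.Perm X) (Q : Finpartition (univ : Finset V)) :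
    Respects (linkGraph blk σ) Q ↔ ∀ x, Q.part (blk x) = Q.part (blk (σ x)) := by
  constructor
  · intro hQ x
    by_cases hx : blk x = blk (σ x)
    · rw [← hx]
    · exact hQ _ _ ⟨⟨x, rfl⟩, hx⟩
  · rintro hQ v w ⟨⟨x, hx⟩, -⟩
    obtain ⟨rfl, rfl⟩ | ⟨rfl, rfl⟩ := Sym2.eq_iff.1 hx
    · exact hQ x
    · exact (hQ x).symm

open scoped Classical in
theorem sum_partitions_prod_det_blocks [Nonempty V] (blk : X → V) (G : Matrix X X R) :
    ∑ Q : Finpartition (univ : Finset V), (-1 : R) ^ (#Q.parts - 1) * (#Q.parts - 1).factorial *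
        ∏ B ∈ Q.parts, (G.submatrix (Subtype.val : {x // blk x ∈ B} → X) Subtype.val).det =
      ∑ σ : Equiv.Perm X with (linkGraph blk σ).Connected,
        ((Equiv.Perm.sign σ : ℤ) : R) * ∏ x, G x (σ x) := by
  simp only [prod_det_blocks, ← respects_linkGraph, mul_sum, sum_filter]
  rw [sum_comm]
  refine sum_congr rfl fun σ _ => ?_
  have hσ := sum_respects_eq_ite_connected (R := R) (linkGraph blk σ)
  rw [sum_filter] at hσ
  rw [← one_mul (_ * _), ← ite_zero_mul, ← hσ, sum_mul]
  simp only [mul_ite_zero, ite_zero_mul, one_mul]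

end BlockDet

section Laplace

open Finset

variable {N : ℕ} {X E F : Type*} [Fintype X] [Fintype E] [Fintype F]

/-- The sign `-1` if the numberings `ρ` and `κ` order `x` and `y` oppositely, with `x` first in
`ρ`. -/
def inversionSign (ρ κ : X ≃ Fin N) (x y : X) : ℤˣ :=
  if ρ x < ρ y ∧ κ y < κ x then -1 else 1

theorem sign_symm_trans_eq_prod (ρ κ : X ≃ Fin N) :
    Equiv.Perm.sign (ρ.symm.trans κ) = ∏ x, ∏ y, inversionSign ρ κ x y := by
  rw [Equiv.Perm.sign_eq_prod_prod_Iio, ← ρ.prod_comp, prod_comm]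
  refine prod_congr rfl fun y _ => ?_
  rw [← filter_gt_eq_Iio, prod_filter, ← ρ.prod_comp]
  refine prod_congr rfl fun x _ => ?_
  have hκ : κ y ≤ κ x ∧ ρ x < ρ y ↔ ρ x < ρ y ∧ κ y < κ x :=
    ⟨fun ⟨hyx, hxy⟩ => ⟨hxy, hyx.lt_of_ne fun h => hxy.ne' (congrArg ρ (κ.injective h))⟩,
      fun ⟨hxy, hyx⟩ => ⟨hyx.le, hxy⟩⟩
  simp only [inversionSign, Equiv.trans_apply, Equiv.symm_apply_apply, ← hκ, ← not_lt]
  split_ifs <;> simp_all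

theorem neg_one_pow_val_eq_prod (ρ : X ≃ Fin N) (x : X) :
    (-1 : ℤˣ) ^ (ρ x : ℕ) = ∏ y, if ρ y < ρ x then -1 else 1 := by
  rw [ρ.prod_comp fun j => if j < ρ x then (-1 : ℤˣ) else 1, ← prod_filter, prod_const,
    filter_gt_eq_Iio, Fin.card_Iio]

theorem neg_one_pow_val_add_val (ρ κ : X ≃ Fin N) (x : X) :
    (-1 : ℤˣ) ^ ((ρ x : ℕ) + (κ x : ℕ)) =
      ∏ y, inversionSign ρ κ x y * inversionSign ρ κ y x := by
  rw [pow_add, neg_one_pow_val_eq_prod, neg_one_pow_val_eq_prod, ← prod_mul_distrib]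
  refine prod_congr rfl fun y _ => ?_
  obtain rfl | hxy := eq_or_ne x y
  · simp [inversionSign]
  · obtain hρ | hρ := (ρ.injective.ne hxy).lt_or_gt <;>
      obtain hκ | hκ := (κ.injective.ne hxy).lt_or_gt <;>
        simp [inversionSign, hρ, hκ, hρ.not_gt, hκ.not_gt]

omit [Fintype F] in
theorem sign_symm_trans_sum [Finite F] [LinearOrder F] {ρ κ : E ⊕ F ≃ Fin N}
    (hρ : StrictMono (ρ ∘ Sum.inr)) (hκ : StrictMono (κ ∘ Sum.inr)) :
    Equiv.Perm.sign (ρ.symm.trans κ) =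
      (∏ e, (-1) ^ ((ρ (.inl e) : ℕ) + (κ (.inl e) : ℕ))) *
        ∏ e, ∏ e', inversionSign ρ κ (.inl e) (.inl e') := by
  cases nonempty_fintype F
  have hE : (∏ e, ∏ e', inversionSign ρ κ (.inl e) (.inl e')) *
      ∏ e, ∏ e', inversionSign ρ κ (.inl e') (.inl e) = 1 := by
    rw [prod_comm (f := fun e e' => inversionSign ρ κ (.inl e') (.inl e)), Int.units_mul_self]
  have hF (a b : F) : inversionSign ρ κ (.inr a) (.inr b) = 1 :=
    if_neg fun ⟨hab, hba⟩ => (hρ.lt_iff_lt.1 hab).asymm (hκ.lt_iff_lt.1 hba)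
  have hmixed : ∏ e, (-1 : ℤˣ) ^ ((ρ (.inl e) : ℕ) + (κ (.inl e) : ℕ)) =
      (∏ e, ∏ a, inversionSign ρ κ (.inl e) (.inr a)) *
        ∏ e, ∏ a, inversionSign ρ κ (.inr a) (.inl e) := by
    simp only [neg_one_pow_val_add_val, Fintype.prod_sum_type, prod_mul_distrib]
    rw [mul_mul_mul_comm, hE, one_mul]
  simp only [sign_symm_trans_eq_prod, hmixed, Fintype.prod_sum_type, prod_mul_distrib, hF,
    prod_const_one, mul_one]
  rw [prod_comm (f := fun a e => inversionSign ρ κ (.inr a) (.inl e)), mul_right_comm, mul_assoc,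
    mul_comm]

variable {R : Type*} [CommRing R]

open scoped Classical in
theorem sum_perm_extending [LinearOrder F] (M : Matrix (Fin N) (Fin N) R) {ρ κ : E ⊕ F ≃ Fin N}
    (hρ : StrictMono (ρ ∘ Sum.inr)) (hκ : StrictMono (κ ∘ Sum.inr)) :
    ∑ σ : Equiv.Perm (Fin N) with ∀ e, σ (ρ (.inl e)) = κ (.inl e),
      ((Equiv.Perm.sign σ : ℤ) : R) * ∏ a, M (ρ (.inr a)) (σ (ρ (.inr a))) =
    (((∏ e, (-1) ^ ((ρ (.inl e) : ℕ) + (κ (.inl e) : ℕ))) *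
        ∏ e, ∏ e', inversionSign ρ κ (.inl e) (.inl e') : ℤˣ) : ℤ) *
      (M.submatrix (ρ ∘ Sum.inr) (κ ∘ Sum.inr)).det := by
  let A : Matrix (E ⊕ F) (E ⊕ F) R :=
    Matrix.fromBlocks 1 0 (M.submatrix (ρ ∘ .inr) (κ ∘ .inl)) (M.submatrix (ρ ∘ .inr) (κ ∘ .inr))
  let M' : Matrix (Fin N) (Fin N) R := A.submatrix ρ.symm κ.symm
  have hinl (e : E) (y : Fin N) : A (.inl e) (κ.symm y) = if y = κ (.inl e) then 1 else 0 := by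
    obtain ⟨e' | a, rfl⟩ := κ.surjective y <;> simp [A, Matrix.one_apply, eq_comm]
  have hinr (a : F) (y : Fin N) : A (.inr a) (κ.symm y) = M (ρ (.inr a)) y := by
    obtain ⟨e | b, rfl⟩ := κ.surjective y <;> simp [A]
  have hpinned (σ : Equiv.Perm (Fin N)) : ∏ x, M' x (σ x) =
      if ∀ e, σ (ρ (.inl e)) = κ (.inl e) then ∏ a, M (ρ (.inr a)) (σ (ρ (.inr a))) else 0 := by
    rw [← ρ.prod_comp, Fintype.prod_sum_type]
    simp [M', hinl, hinr, prod_ite_zero]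
  have hdet : M'.det = Equiv.Perm.sign (ρ.symm.trans κ) * A.det := by
    have hM' : M' = (A.submatrix κ.symm κ.symm).submatrix (ρ.symm.trans κ) id := by
      ext x y
      simp only [M', Matrix.submatrix_apply, Equiv.trans_apply, Equiv.symm_apply_apply, id_eq]
    rw [hM', Matrix.det_permute, Matrix.det_submatrix_equiv_self]
  rw [← sign_symm_trans_sum hρ hκ, sum_filter]
  simp only [← mul_ite_zero, ← hpinned]
  rw [← det_eq_sum_sign_mul_prod_row, hdet, Matrix.det_fromBlocks_zero₁₂, Matrix.det_one, one_mul]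

end Laplace

/-! ### Growing trees -/

section GrowingTrees

open Finset

theorem exists_adj_dist_eq_add_one {V : Type*} {G : SimpleGraph V} (hG : G.Connected) {o v : V}
    (hv : v ≠ o) : ∃ u, G.Adj u v ∧ G.dist o v = G.dist o u + 1 := by
  obtain ⟨w, hw⟩ := hG.exists_walk_length_eq_dist v o
  cases w with
  | nil => exact absurd rfl hv
  | @cons _ u _ huv w =>
    have hle : G.dist o u ≤ w.length := G.dist_comm (u := o) ▸ SimpleGraph.dist_le w
    have htriangle : G.dist o v ≤ G.dist o u + G.dist u v := hG.dist_triangle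
    rw [SimpleGraph.dist_eq_one_iff_adj.2 huv.symm] at htriangle
    rw [SimpleGraph.Walk.length_cons, G.dist_comm] at hw
    exact ⟨u, huv.symm, by lia⟩

variable {n : ℕ} {ω : Equiv.Perm (Fin (n + 1))} {p q : Fin n → Fin (n + 1)}

theorem mem_visited {i : Fin n} {v : Fin (n + 1)} : v ∈ visited ω i ↔ ω.symm v < i.succ := by
  obtain ⟨j, rfl⟩ := ω.surjective v
  rw [visited, ω.injective.mem_finset_image, mem_Iic, ω.symm_apply_apply, Fin.le_castSucc_iff]

/-- The graph on `[n + 1]` in which the vertex visited at step `i + 1` of `ω` is joined to the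
vertex `p i`. It is a tree if each `p i` has been visited before. -/
def growTree (ω : Equiv.Perm (Fin (n + 1))) (p : Fin n → Fin (n + 1)) : SimpleGraph (Fin (n + 1)) :=
  SimpleGraph.fromEdgeSet (Set.range fun i => s(ω i.succ, p i))

theorem succ_ne_of_mem_visited {i : Fin n} {v : Fin (n + 1)} (hv : v ∈ visited ω i) :
    ω i.succ ≠ v := by
  rintro rfl
  simp [mem_visited] at hv

theorem growTree_adj (hp : ∀ i, p i ∈ visited ω i) (i : Fin n) :
    (growTree ω p).Adj (ω i.succ) (p i) :=
  ⟨⟨i, rfl⟩, succ_ne_of_mem_visited (hp i)⟩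

theorem eq_and_eq_of_mk_eq {i k : Fin n} {u v : Fin (n + 1)} (hu : u ∈ visited ω i)
    (hv : v ∈ visited ω k) (h : s(ω i.succ, u) = s(ω k.succ, v)) : i = k ∧ u = v := by
  obtain ⟨hik, rfl⟩ | ⟨rfl, rfl⟩ := Sym2.eq_iff.1 h
  · exact ⟨Fin.succ_injective _ (ω.injective hik), rfl⟩
  · simp only [mem_visited, Equiv.symm_apply_apply] at hu hv
    exact absurd hu hv.not_gt

theorem growTree_mk_injective (hp : ∀ i, p i ∈ visited ω i) :
    Function.Injective fun i => s(ω i.succ, p i) :=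
  fun i k h => (eq_and_eq_of_mk_eq (hp i) (hp k) h).1

theorem growTree_adj_iff (hp : ∀ i, p i ∈ visited ω i) {i : Fin n} {v : Fin (n + 1)}
    (hv : v ∈ visited ω i) : (growTree ω p).Adj (ω i.succ) v ↔ v = p i := by
  constructor
  · rintro ⟨⟨k, hk⟩, -⟩
    obtain ⟨rfl, h⟩ := eq_and_eq_of_mk_eq (hp k) hv hk
    exact h.symm
  · rintro rfl
    exact growTree_adj hp i

theorem edgeSet_growTree (hp : ∀ i, p i ∈ visited ω i) :
    (growTree ω p).edgeSet = Set.range fun i => s(ω i.succ, p i) := by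
  rw [growTree, SimpleGraph.edgeSet_fromEdgeSet, sdiff_eq_left, Set.disjoint_left]
  rintro _ ⟨i, rfl⟩ hdiag
  exact succ_ne_of_mem_visited (hp i) hdiag

theorem growTree_connected (hp : ∀ i, p i ∈ visited ω i) : (growTree ω p).Connected := by
  have hreach (j : Fin (n + 1)) : (growTree ω p).Reachable (ω 0) (ω j) := by
    induction j using WellFoundedLT.induction with
    | _ j ih =>
      obtain rfl | ⟨i, rfl⟩ := Fin.eq_zero_or_eq_succ j
      · rfl
      · have hparent := ih _ (mem_visited.1 (hp i))
        rw [ω.apply_symm_apply] at hparent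
        exact hparent.trans (growTree_adj hp i).symm.reachable
  refine SimpleGraph.connected_iff_exists_forall_reachable _ |>.2 ⟨ω 0, fun v => ?_⟩
  exact ω.apply_symm_apply v ▸ hreach (ω.symm v)

theorem growTree_isTree (hp : ∀ i, p i ∈ visited ω i) : (growTree ω p).IsTree := by
  refine SimpleGraph.isTree_iff_connected_and_card.2 ⟨growTree_connected hp, ?_⟩
  rw [edgeSet_growTree hp, Nat.card_range_of_injective (growTree_mk_injective hp)]
  simp

theorem growTree_dist_lt (hp : ∀ i, p i ∈ visited ω i) (hω : ω 0 = 0) (i : Fin n) :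
    (growTree ω p).dist 0 (p i) < (growTree ω p).dist 0 (ω i.succ) := by
  induction hd : (growTree ω p).dist 0 (ω i.succ) using Nat.strong_induction_on generalizing i with
  | _ d ih =>
    have hne : ω i.succ ≠ 0 := hω ▸ ω.injective.ne (Fin.succ_ne_zero i)
    obtain ⟨u, ⟨⟨k, hk⟩, -⟩, hdist⟩ := exists_adj_dist_eq_add_one (growTree_connected hp) hne
    obtain ⟨rfl, hpk⟩ | ⟨hki, rfl⟩ := Sym2.eq_iff.1 hk
    · have := ih _ (by lia) k rfl
      rw [hpk] at this
      lia
    · obtain rfl := Fin.succ_injective _ (ω.injective hki)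
      lia

theorem growTree_growing (hp : ∀ i, p i ∈ visited ω i) (hω : ω 0 = 0) (u v : Fin (n + 1))
    (h : IsParent ⟨growTree ω p, growTree_isTree hp⟩ u v) : ω.symm u < ω.symm v := by
  obtain ⟨⟨⟨k, hk⟩, -⟩, hdist⟩ := h
  obtain ⟨rfl, rfl⟩ | ⟨rfl, rfl⟩ := Sym2.eq_iff.1 hk
  · have := growTree_dist_lt hp hω k
    lia
  · simpa only [Equiv.symm_apply_apply] using mem_visited.1 (hp k)

theorem exists_growTree_eq (hω : ω 0 = 0) (T : LabeledTree (n + 1))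
    (hT : ∀ u v, IsParent T u v → ω.symm u < ω.symm v) :
    ∃ p : Fin n → Fin (n + 1), (∀ i, p i ∈ visited ω i) ∧ growTree ω p = T.1 := by
  have hparent (i : Fin n) : ∃ u, IsParent T u (ω i.succ) :=
    exists_adj_dist_eq_add_one T.2.1 (hω ▸ ω.injective.ne (Fin.succ_ne_zero i))
  choose p hp using hparent
  have hvisited (i : Fin n) : p i ∈ visited ω i := by
    simpa only [mem_visited, Equiv.symm_apply_apply] using hT _ _ (hp i)
  have hle : growTree ω p ≤ T.1 := by
    rw [← SimpleGraph.edgeSet_subset_edgeSet, edgeSet_growTree hvisited]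
    rintro _ ⟨i, rfl⟩
    exact (hp i).1.symm
  exact ⟨p, hvisited, le_antisymm hle
    ((SimpleGraph.isTree_iff_minimal_connected.1 T.2).2 (growTree_connected hvisited) hle)⟩

theorem growTree_injective (hp : ∀ i, p i ∈ visited ω i) (hq : ∀ i, q i ∈ visited ω i)
    (h : growTree ω p = growTree ω q) : p = q := by
  funext i
  rw [← growTree_adj_iff hq (hp i), ← h]
  exact growTree_adj hp i

theorem edge_mk_injective {s : ℕ} {T : LabeledTree s} :
    Function.Injective fun e : Edge T => s(e.1.1, e.1.2) := by
  rintro ⟨⟨i, j⟩, hij, _⟩ ⟨⟨k, l⟩, hkl, _⟩ h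
  obtain ⟨rfl, rfl⟩ | ⟨rfl, rfl⟩ := Sym2.eq_iff.1 h
  · rfl
  · exact absurd hij hkl.not_gt

theorem range_edge_mk {s : ℕ} (T : LabeledTree s) :
    Set.range (fun e : Edge T => s(e.1.1, e.1.2)) = T.1.edgeSet := by
  refine Set.Subset.antisymm ?_ fun z => Sym2.ind (fun i j hij => ?_) z
  · rintro _ ⟨e, rfl⟩
    exact e.2.2
  · obtain h | h := (SimpleGraph.Adj.ne hij).lt_or_gt
    · exact ⟨⟨(i, j), h, hij⟩, rfl⟩
    · exact ⟨⟨(j, i), h, SimpleGraph.Adj.symm hij⟩, Sym2.eq_swap⟩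

variable {R : Type*} [CommSemiring R]

theorem prod_edge_growTree (hp : ∀ i, p i ∈ visited ω i) (F : Sym2 (Fin (n + 1)) → R) :
    ∏ e : Edge ⟨growTree ω p, growTree_isTree hp⟩, F s(e.1.1, e.1.2) =
      ∏ i, F s(ω i.succ, p i) := by
  classical
  rw [← prod_image (g := fun e : Edge ⟨growTree ω p, growTree_isTree hp⟩ => s(e.1.1, e.1.2))
      edge_mk_injective.injOn,
    ← prod_image (g := fun i => s(ω i.succ, p i)) (growTree_mk_injective hp).injOn]
  congr 1
  rw [← coe_inj, coe_image, coe_image, coe_univ, coe_univ, Set.image_univ, Set.image_univ,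
    range_edge_mk, edgeSet_growTree hp]

open scoped Classical in
theorem sum_growing_trees (hω : ω 0 = 0) (F : Sym2 (Fin (n + 1)) → R) :
    ∑ T : LabeledTree (n + 1) with ∀ u v, IsParent T u v → ω.symm u < ω.symm v,
      ∏ e : Edge T, F s(e.1.1, e.1.2) =
    ∏ i : Fin n, ∑ v ∈ visited ω i, F s(ω i.succ, v) := by
  rw [prod_univ_sum]
  symm
  refine sum_bij (fun p hp => ⟨growTree ω p, growTree_isTree (Fintype.mem_piFinset.1 hp)⟩)
    (fun p hp => mem_filter.2 ⟨mem_univ _, growTree_growing (Fintype.mem_piFinset.1 hp) hω⟩)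
    (fun p hp q hq h => growTree_injective (Fintype.mem_piFinset.1 hp) (Fintype.mem_piFinset.1 hq)
      (congrArg Subtype.val h))
    (fun T hT => ?_)
    (fun p hp => (prod_edge_growTree (Fintype.mem_piFinset.1 hp) F).symm)
  obtain ⟨p, hp, hpT⟩ := exists_growTree_eq hω T (mem_filter.1 hT).2
  exact ⟨p, Fintype.mem_piFinset.2 hp, Subtype.ext hpT⟩

end GrowingTrees

section Paths

open Finset

theorem sum_prod_history {V R : Type*} [Fintype V] [DecidableEq V] [CommSemiring R]
    (g : Finset V → V → R) (o : V) {n : ℕ} (hg : ∀ S, o ∈ S → #S ≤ n → ∑ v, g S v = 1) :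
    ∑ u : Fin n → V, ∏ i, g (insert o ((Iio i).image u)) (u i) = 1 := by
  induction n with
  | zero => simp
  | succ n ih =>
    have hlast (v : V) (u : Fin n → V) :
        ∏ i, g (insert o ((Iio i).image (Fin.snoc u v : Fin (n + 1) → V)))
          ((Fin.snoc u v : Fin (n + 1) → V) i) =
        (∏ i, g (insert o ((Iio i).image u)) (u i)) * g (insert o (univ.image u)) v := by
      simp only [Fin.prod_univ_castSucc, Fin.snoc_castSucc, Fin.snoc_last,
        ← Fin.map_castSuccEmb_Iio, Fin.Iio_last_eq_map, map_eq_image, image_image,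
        Function.comp_def, Fin.coe_castSuccEmb]
    rw [← (Fin.snocEquiv fun _ : Fin (n + 1) => V).sum_comp, Fintype.sum_prod_type_right]
    simp only [Fin.snocEquiv, Equiv.coe_fn_mk, hlast, ← mul_sum]
    rw [← ih fun S ho hS => hg S ho (hS.trans n.le_succ)]
    refine sum_congr rfl fun u _ => ?_
    rw [hg _ (mem_insert_self _ _), mul_one]
    exact (card_insert_le _ _).trans (Nat.succ_le_succ (card_image_le.trans_eq (card_fin n)))

theorem sum_perm_fixing_zero {R : Type*} [AddCommMonoid R] {n : ℕ}
    (F : (Fin n → Fin (n + 1)) → R)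
    (hF : ∀ u, F u ≠ 0 → Function.Injective (Fin.cons 0 u : Fin (n + 1) → Fin (n + 1))) :
    ∑ ω : Equiv.Perm (Fin (n + 1)) with ω 0 = 0, F (fun i => ω i.succ) = ∑ u, F u := by
  refine sum_of_injOn (fun ω i => ω i.succ) (fun ω hω ω' hω' h => ?_)
    (fun _ _ => mem_coe.2 (mem_univ _)) (fun u _ hu => ?_) (fun _ _ => rfl)
  · ext1 j
    obtain rfl | ⟨i, rfl⟩ := Fin.eq_zero_or_eq_succ j
    · exact (mem_filter.1 hω).2.trans (mem_filter.1 hω').2.symm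
    · exact congrFun h i
  · by_contra hne
    exact hu ⟨Equiv.ofBijective _ (Finite.injective_iff_bijective.1 (hF u hne)), by simp, by simp⟩

section Links

variable {X : Type*} [Fintype X]

/-- The number of links of the permutation `σ` between the two blocks of the pair `z`. -/
def linkCount {V : Type*} [DecidableEq V] (blk : X → V) (σ : Equiv.Perm X) (z : Sym2 V) : ℕ :=
  #{x | s(blk x, blk (σ x)) = z}

variable {n : ℕ}

/-- The number of links of the permutation `σ` that cross `S`. -/
def crossCount (blk : X → Fin (n + 1)) (σ : Equiv.Perm X) (S : Finset (Fin (n + 1))) : ℕ :=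
  #{x | Crosses S (blk x) (blk (σ x))}

variable {S : Finset (Fin (n + 1))}

theorem crosses_iff_exists {u v : Fin (n + 1)} :
    Crosses S u v ↔ ∃ a ∈ Sᶜ, ∃ b ∈ S, s(a, b) = s(u, v) := by
  simp only [Crosses, mem_compl, Sym2.eq_iff]
  constructor
  · rintro (⟨hu, hv⟩ | ⟨hv, hu⟩)
    · exact ⟨v, hv, u, hu, Or.inr ⟨rfl, rfl⟩⟩
    · exact ⟨u, hu, v, hv, Or.inl ⟨rfl, rfl⟩⟩
  · rintro ⟨a, ha, b, hb, ⟨rfl, rfl⟩ | ⟨rfl, rfl⟩⟩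
    · exact Or.inr ⟨hb, ha⟩
    · exact Or.inl ⟨hb, ha⟩

theorem crosses_congr {u v u' v' : Fin (n + 1)} (h : s(u, v) = s(u', v')) :
    Crosses S u v ↔ Crosses S u' v' := by
  rw [crosses_iff_exists, crosses_iff_exists, h]

theorem crossCount_eq_sum_linkCount (blk : X → Fin (n + 1)) (σ : Equiv.Perm X) :
    crossCount blk σ S = ∑ a ∈ Sᶜ, ∑ b ∈ S, linkCount blk σ s(a, b) := by
  have hinj : Set.InjOn (fun q : Fin (n + 1) × Fin (n + 1) => s(q.1, q.2)) ↑(Sᶜ ×ˢ S) := by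
    rintro ⟨a, b⟩ hab ⟨a', b'⟩ hab' h
    obtain ⟨rfl, rfl⟩ | ⟨rfl, rfl⟩ := Sym2.eq_iff.1 h
    · rfl
    · simp_all
  rw [← sum_product', ← sum_image (f := linkCount blk σ) hinj]
  simp only [linkCount]
  rw [sum_card_fiberwise_eq_card_filter, crossCount]
  congr! 2 with x
  rw [crosses_iff_exists]
  simp [and_assoc]

variable {blk : X → Fin (n + 1)} {σ : Equiv.Perm X}

theorem exists_adj_crosses {G : SimpleGraph (Fin (n + 1))} (hG : G.Connected) (hne : S.Nonempty)
    (hS : #S ≤ n) : ∃ z ∈ G.edgeSet, ∀ u v, s(u, v) = z → Crosses S u v := by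
  obtain ⟨a, ha⟩ := hne
  obtain ⟨b, hb⟩ : ∃ b, b ∉ S := by
    by_contra! hall
    rw [eq_univ_of_forall hall, card_fin] at hS
    exact n.lt_irrefl hS
  obtain ⟨w⟩ := hG.preconnected a b
  obtain ⟨d, -, hfst, hsnd⟩ := w.exists_boundary_dart S (mem_coe.2 ha) (mt mem_coe.1 hb)
  exact ⟨_, d.adj, fun u v huv =>
    (crosses_congr huv).2 (Or.inl ⟨mem_coe.1 hfst, mt mem_coe.2 hsnd⟩)⟩

theorem crossCount_pos (hσ : (linkGraph blk σ).Connected) (hne : S.Nonempty) (hS : #S ≤ n) :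
    0 < crossCount blk σ S := by
  obtain ⟨z, hz, hcross⟩ := exists_adj_crosses hσ hne hS
  rw [linkGraph, SimpleGraph.edgeSet_fromEdgeSet] at hz
  obtain ⟨⟨x, hx⟩, -⟩ := hz
  exact card_pos.2 ⟨x, mem_filter.2 ⟨mem_univ x, hcross _ _ hx⟩⟩

/-- The probability that a path that has visited `S` continues to `v`, if it follows a uniformly
chosen link among those of the permutation `σ` that cross `S`. -/
def stepProbability (blk : X → Fin (n + 1)) (σ : Equiv.Perm X) (S : Finset (Fin (n + 1)))
    (v : Fin (n + 1)) : ℝ :=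
  if v ∈ S then 0 else (∑ w ∈ S, (linkCount blk σ s(v, w) : ℝ)) / crossCount blk σ S

theorem sum_stepProbability (hσ : (linkGraph blk σ).Connected) (hne : S.Nonempty) (hS : #S ≤ n) :
    ∑ v, stepProbability blk σ S v = 1 := by
  have hpos : (crossCount blk σ S : ℝ) ≠ 0 := mod_cast (crossCount_pos hσ hne hS).ne'
  simp only [stepProbability, ← ite_not (_ ∈ S), ← mem_compl]
  rw [← sum_filter, filter_univ_mem, ← sum_div, div_eq_one_iff_eq hpos,
    crossCount_eq_sum_linkCount]
  push_cast
  rfl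

theorem visited_eq_insert {ω : Equiv.Perm (Fin (n + 1))} (hω : ω 0 = 0) (i : Fin n) :
    visited ω i = insert 0 ((Iio i).image fun j => ω j.succ) := by
  ext w
  simp only [visited, mem_image, mem_Iic, mem_insert, mem_Iio, Fin.exists_fin_succ, hω,
    Fin.zero_le, true_and, Fin.succ_le_castSucc_iff, eq_comm]

theorem cons_injective_of_notMem {u : Fin n → Fin (n + 1)}
    (hu : ∀ i, u i ∉ insert 0 ((Iio i).image u)) :
    Function.Injective (Fin.cons 0 u : Fin (n + 1) → Fin (n + 1)) := by
  simp only [mem_insert, mem_image, mem_Iio, not_or, not_exists, not_and] at hu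
  refine Fin.cons_injective_iff.2
    ⟨fun ⟨i, hi⟩ => (hu i).1 hi, .of_lt_imp_ne fun i j hij h => (hu j).2 i hij h⟩

theorem sum_growing_paths (hσ : (linkGraph blk σ).Connected) :
    ∑ ω : Equiv.Perm (Fin (n + 1)) with ω 0 = 0, ∏ i : Fin n,
      (∑ v ∈ visited ω i, (linkCount blk σ s(ω i.succ, v) : ℝ)) / crossCount blk σ (visited ω i) =
    1 := by
  rw [← sum_prod_history (stepProbability blk σ) 0 fun S h₀ hS =>
      sum_stepProbability hσ ⟨0, h₀⟩ hS,
    ← sum_perm_fixing_zero]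
  · refine sum_congr rfl fun ω hω => prod_congr rfl fun i _ => ?_
    rw [← visited_eq_insert (mem_filter.1 hω).2, stepProbability,
      if_neg fun h => succ_ne_of_mem_visited h rfl]
  · intro u hu
    exact cons_injective_of_notMem fun i hi =>
      prod_ne_zero_iff.1 hu i (mem_univ i) (if_pos hi)

end Links

open MeasureTheory in
theorem integral_unitCube_prod_pow {ι : Type*} [Fintype ι] (k : ι → ℕ) :
    ∫ t in Set.Icc (0 : ι → ℝ) 1, ∏ i, t i ^ k i = ∏ i, (1 / (k i + 1) : ℝ) := by
  rw [← Set.pi_univ_Icc, volume_pi, Measure.restrict_pi_pi,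
    integral_fintype_prod_eq_prod fun i (x : ℝ) => x ^ k i]
  refine prod_congr rfl fun i _ => ?_
  rw [Pi.zero_apply, Pi.one_apply, integral_Icc_eq_integral_Ioc,
    ← intervalIntegral.integral_of_le zero_le_one, integral_pow]
  simp

end Paths

section Assignments

open Finset

variable {Ω : Type*} {s : ℕ} {P : Fin s → Interaction Ω} {T : LabeledTree s}

/-- The block to which a row or column number belongs. -/
def block (P : Fin s → Interaction Ω) (x : Fin (∑ i, (P i).m)) : Fin s :=
  (finSigmaFinEquiv.symm x).1

theorem block_pos (x : Leg P) : block P (pos P x) = x.1 := by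
  rw [block, pos, Equiv.symm_apply_apply]

theorem pos_injective : Function.Injective (pos P) := finSigmaFinEquiv.injective

theorem row_injective (χ : Assignment P T) : Function.Injective (row χ) :=
  pos_injective.comp χ.2.1

theorem col_injective (χ : Assignment P T) : Function.Injective (col χ) :=
  pos_injective.comp χ.2.2

/-- The annihilation and the creation operator contracted by a triple `χ_{ij} = (σ, k, l)`. -/
def contractedLegs (P : Fin s → Interaction Ω) (i j : Fin s)
    (c : ℤˣ × Fin (P i).m × Fin (P j).m) : Leg P × Leg P :=
  (if c.1 = 1 then ⟨j, c.2.2⟩ else ⟨i, c.2.1⟩, if c.1 = 1 then ⟨i, c.2.1⟩ else ⟨j, c.2.2⟩)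

theorem contractedLegs_injective {i j : Fin s} (hij : i ≠ j) :
    Function.Injective (contractedLegs P i j) := by
  rintro ⟨ε, k, l⟩ ⟨ε', k', l'⟩ h
  obtain rfl | rfl := Int.units_eq_one_or ε <;> obtain rfl | rfl := Int.units_eq_one_or ε' <;>
    simp_all [contractedLegs, Prod.ext_iff]

theorem range_contractedLegs (i j : Fin s) :
    Set.range (contractedLegs P i j) = {q | s(q.1.1, q.2.1) = s(i, j)} := by
  ext ⟨⟨a, k⟩, ⟨b, l⟩⟩
  constructor
  · rintro ⟨⟨ε, k', l'⟩, hc⟩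
    rw [← hc, contractedLegs]
    obtain rfl | rfl := Int.units_eq_one_or ε <;> simp
  · intro h
    obtain ⟨rfl, rfl⟩ | ⟨rfl, rfl⟩ := Sym2.eq_iff.1 h
    · exact ⟨(-1, k, l), by simp [contractedLegs]⟩
    · exact ⟨(1, l, k), by simp [contractedLegs]⟩

theorem mk_annihLeg_creatLeg (χ : PreAssignment P T) (e : Edge T) :
    s((annihLeg χ e).1, (creatLeg χ e).1) = s(e.1.1, e.1.2) :=
  (range_contractedLegs e.1.1 e.1.2).subset ⟨χ e, rfl⟩

theorem mk_block_row_col (χ : Assignment P T) (e : Edge T) :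
    s(block P (row χ e), block P (col χ e)) = s(e.1.1, e.1.2) := by
  rw [row, col, block_pos, block_pos, mk_annihLeg_creatLeg]

theorem card_contractedLegs (σ : Equiv.Perm (Fin (∑ i, (P i).m))) {i j : Fin s} (hij : i ≠ j) :
    #{c | σ (pos P (contractedLegs P i j c).1) = pos P (contractedLegs P i j c).2} =
      linkCount (block P) σ s(i, j) := by
  refine card_bij (fun c _ => pos P (contractedLegs P i j c).1) (fun c hc => ?_)
    (fun c hc c' hc' h => ?_) (fun x hx => ?_)
  · rw [mem_filter, (mem_filter.1 hc).2, block_pos, block_pos]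
    exact ⟨mem_univ _, (range_contractedLegs i j).subset ⟨c, rfl⟩⟩
  · refine contractedLegs_injective hij (Prod.ext (pos_injective h) (pos_injective ?_))
    rw [← (mem_filter.1 hc).2, ← (mem_filter.1 hc').2, h]
  · have hlegs : (finSigmaFinEquiv.symm x, finSigmaFinEquiv.symm (σ x)) ∈
        Set.range (contractedLegs P i j) := by
      rw [range_contractedLegs]
      exact (mem_filter.1 hx).2
    obtain ⟨c, hc⟩ := hlegs
    have hσ : σ (pos P (contractedLegs P i j c).1) = pos P (contractedLegs P i j c).2 := by
      simp [hc, pos]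
    exact ⟨c, mem_filter.2 ⟨mem_univ c, hσ⟩, by simp [hc, pos]⟩

/-- The permutation `σ` extends the matching of rows and columns given by `χ`. -/
def Extends (σ : Equiv.Perm (Fin (∑ i, (P i).m))) (χ : Assignment P T) : Prop :=
  ∀ e, σ (row χ e) = col χ e

theorem injective_of_forall_perm_eq {σ : Equiv.Perm (Fin (∑ i, (P i).m))} {χ : PreAssignment P T}
    (hσ : ∀ e, σ (pos P (annihLeg χ e)) = pos P (creatLeg χ e)) :
    Function.Injective (annihLeg χ) ∧ Function.Injective (creatLeg χ) := by
  have hedge {e e' : Edge T} (ha : annihLeg χ e = annihLeg χ e')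
      (hc : creatLeg χ e = creatLeg χ e') : e = e' :=
    edge_mk_injective <| by
      beta_reduce
      rw [← mk_annihLeg_creatLeg χ e, ha, hc, mk_annihLeg_creatLeg]
  constructor
  · intro e e' h
    exact hedge h (pos_injective (by rw [← hσ, h, hσ]))
  · intro e e' h
    exact hedge (pos_injective (σ.injective (by rw [hσ, h, hσ]))) h

open scoped Classical in
theorem card_extended_assignments (T : LabeledTree s) (σ : Equiv.Perm (Fin (∑ i, (P i).m))) :
    #{χ : Assignment P T | Extends σ χ} =
      ∏ e : Edge T, linkCount (block P) σ s(e.1.1, e.1.2) := by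
  have hpi : #{χ : Assignment P T | Extends σ χ} = #(Fintype.piFinset fun e : Edge T =>
      {c | σ (pos P (contractedLegs P e.1.1 e.1.2 c).1) =
        pos P (contractedLegs P e.1.1 e.1.2 c).2}) := by
    refine card_bij (fun χ _ => χ.1) (fun χ hχ => ?_) (fun _ _ _ _ => Subtype.ext) fun χ hχ => ?_
    · exact Fintype.mem_piFinset.2 fun e => mem_filter.2 ⟨mem_univ _, (mem_filter.1 hχ).2 e⟩
    · have hσ (e : Edge T) := (mem_filter.1 (Fintype.mem_piFinset.1 hχ e)).2
      exact ⟨⟨χ, injective_of_forall_perm_eq hσ⟩, mem_filter.2 ⟨mem_univ _, hσ⟩, rfl⟩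
  rw [hpi, Fintype.card_piFinset]
  exact prod_congr rfl fun e _ => card_contractedLegs σ e.2.1.ne

end Assignments

section Interpolation

open Finset

variable {Ω : Type*} {n : ℕ} {P : Fin (n + 1) → Interaction Ω} {T : LabeledTree (n + 1)}

theorem crossingNumber_pos (T : LabeledTree (n + 1)) (ω : Equiv.Perm (Fin (n + 1))) (i : Fin n) :
    0 < crossingNumber T ω i := by
  have hne : (visited ω i).Nonempty := ⟨ω 0, mem_visited.2 (by simp [Fin.lt_def])⟩
  have hcard : #(visited ω i) ≤ n := by
    rw [visited, card_image_of_injective _ ω.injective, Fin.card_Iic]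
    exact i.2
  obtain ⟨z, hz, hcross⟩ := exists_adj_crosses T.2.1 hne hcard
  rw [← range_edge_mk] at hz
  obtain ⟨e, rfl⟩ := hz
  exact card_pos.2 ⟨e, mem_filter.2 ⟨mem_univ _, hcross _ _ rfl⟩⟩

theorem crossCount_eq_add {χ : Assignment P T} {σ : Equiv.Perm (Fin (∑ i, (P i).m))}
    (hσ : Extends σ χ) (ω : Equiv.Perm (Fin (n + 1))) (i : Fin n) :
    crossCount (block P) σ (visited ω i) =
      #{x ∈ freeRows χ | Crosses (visited ω i) (block P x) (block P (σ x))} +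
        crossingNumber T ω i := by
  have hedges : crossingNumber T ω i = #{x ∈ univ.image (row χ) |
      Crosses (visited ω i) (block P x) (block P (σ x))} := by
    rw [filter_image, card_image_of_injective _ (row_injective χ), crossingNumber]
    refine congrArg card (filter_congr fun e _ => ?_)
    rw [hσ, crosses_congr (mk_block_row_col χ e)]
  rw [hedges, crossCount, freeRows, ← card_union_of_disjoint, ← filter_union, union_comm,
    union_compl]
  exact disjoint_filter_filter (disjoint_left.2 fun x hx => mem_compl.1 hx)

theorem integral_pathDensity_mul_weights {χ : Assignment P T}
    {σ : Equiv.Perm (Fin (∑ i, (P i).m))} (hσ : Extends σ χ) (ω : Equiv.Perm (Fin (n + 1))) :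
    ∫ t in Set.Icc (0 : Fin n → ℝ) 1, pathDensity T ω t *
      ∏ x ∈ freeRows χ, weight ω t (block P x) (block P (σ x)) =
    ∏ i, (1 / crossCount (block P) σ (visited ω i) : ℝ) := by
  have hpos (i : Fin n) := crossingNumber_pos T ω i
  have hmonomial (t : Fin n → ℝ) : pathDensity T ω t *
      ∏ x ∈ freeRows χ, weight ω t (block P x) (block P (σ x)) =
      ∏ i, t i ^ (crossCount (block P) σ (visited ω i) - 1) := by
    simp only [pathDensity, weight, prod_filter]
    rw [prod_comm, ← prod_mul_distrib]
    refine prod_congr rfl fun i _ => ?_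
    rw [← prod_filter, prod_const, ← pow_add, crossCount_eq_add hσ, add_comm,
      Nat.add_sub_assoc (hpos i)]
  simp only [hmonomial]
  rw [integral_unitCube_prod_pow]
  refine prod_congr rfl fun i _ => ?_
  rw [Nat.cast_sub (by rw [crossCount_eq_add hσ]; exact (hpos i).trans_le le_add_self),
    Nat.cast_one, sub_add_cancel]

theorem prod_linkCount_eq_zero {V X : Type*} [Fintype X] [DecidableEq V]
    {G : SimpleGraph V} (hG : G.Connected) {ι : Type*} [Fintype ι] {edge : ι → Sym2 V}
    (hedge : G.edgeSet ⊆ Set.range edge) {blk : X → V} {σ : Equiv.Perm X}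
    (h : ¬ (linkGraph blk σ).Connected) : ∏ e, linkCount blk σ (edge e) = 0 := by
  by_contra hne
  refine h (hG.mono fun u v huv => ?_)
  obtain ⟨e, he⟩ := hedge ((SimpleGraph.mem_edgeSet G).2 huv)
  obtain ⟨x, hx⟩ := card_pos.1 (Nat.pos_of_ne_zero (prod_ne_zero_iff.1 hne e (mem_univ e)))
  rw [linkGraph, SimpleGraph.fromEdgeSet_adj]
  exact ⟨⟨x, (mem_filter.1 hx).2.trans he⟩, huv.ne⟩

open scoped Classical in
theorem sum_growingPath {R : Type*} [AddCommMonoid R] (T : LabeledTree (n + 1))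
    (f : Equiv.Perm (Fin (n + 1)) → R) :
    ∑ ω : GrowingPath T, f ω.1 = ∑ ω : Equiv.Perm (Fin (n + 1)) with ω 0 = 0,
      if ∀ u v, IsParent T u v → ω.symm u < ω.symm v then f ω else 0 := by
  rw [← sum_filter, filter_filter]
  exact (sum_subtype _ (by simp) f).symm

open scoped Classical in
theorem sum_trees_growingPaths {X : Type*} [Fintype X] (blk : X → Fin (n + 1))
    (σ : Equiv.Perm X) :
    ∑ T : LabeledTree (n + 1), (∏ e : Edge T, (linkCount blk σ s(e.1.1, e.1.2) : ℝ)) *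
      ∑ ω : GrowingPath T, ∏ i, (1 / crossCount blk σ (visited ω.1 i) : ℝ) =
    if (linkGraph blk σ).Connected then 1 else 0 := by
  split_ifs with hσ
  · refine Eq.trans ?_ (sum_growing_paths hσ)
    simp only [sum_growingPath _ fun ω => ∏ i, (1 / crossCount blk σ (visited ω i) : ℝ), mul_sum]
    rw [sum_comm]
    refine sum_congr rfl fun ω hω => ?_
    simp only [prod_div_distrib, prod_const_one]
    rw [← sum_growing_trees (mem_filter.1 hω).2
      (fun z => (linkCount blk σ z : ℝ)), sum_filter, sum_div]
    refine sum_congr rfl fun T _ => ?_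
    rw [mul_ite, mul_one_div, mul_zero, ite_div, zero_div]
  · refine sum_eq_zero fun T _ => ?_
    rw [← Nat.cast_prod, prod_linkCount_eq_zero T.2.1 (range_edge_mk T).superset hσ, Nat.cast_zero,
      zero_mul]

open scoped Classical in
/-- The coefficient of the permutation `σ` in the remainder of `(T, χ)`. When `σ` extends `χ`, it is
the probability that random growth along the links of `σ`, each new link being uniform among those
that cross the visited set, produces the tree `T` with the contractions `χ`. -/
def interpolationWeight (χ : Assignment P T) (σ : Equiv.Perm (Fin (∑ i, (P i).m))) : ℝ :=
  ∑ ω : GrowingPath T, ∫ t in Set.Icc (0 : Fin n → ℝ) 1, pathDensity T ω.1 t *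
    ∏ x ∈ freeRows χ, weight ω.1 t (block P x) (block P (σ x))

open scoped Classical in
theorem sum_trees_interpolationWeight (σ : Equiv.Perm (Fin (∑ i, (P i).m))) :
    ∑ T : LabeledTree (n + 1), ∑ χ : Assignment P T with Extends σ χ, interpolationWeight χ σ =
      if (linkGraph (block P) σ).Connected then 1 else 0 := by
  rw [← sum_trees_growingPaths]
  refine sum_congr rfl fun T _ => ?_
  have hχ (χ : Assignment P T) (h : Extends σ χ) : interpolationWeight χ σ =
      ∑ ω : GrowingPath T, ∏ i, (1 / crossCount (block P) σ (visited ω.1 i) : ℝ) :=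
    sum_congr rfl fun ω _ => integral_pathDensity_mul_weights h ω.1
  rw [sum_congr rfl fun χ h => hχ χ (mem_filter.1 h).2, sum_const, card_extended_assignments,
    nsmul_eq_mul, Nat.cast_prod]

open scoped Classical in
theorem sum_connected_eq_sum_trees {M : Type*} [AddCommGroup M] [Module ℝ M]
    (f : Equiv.Perm (Fin (∑ i, (P i).m)) → M) :
    ∑ σ : Equiv.Perm (Fin (∑ i, (P i).m)) with (linkGraph (block P) σ).Connected, f σ =
      ∑ T : LabeledTree (n + 1), ∑ χ : Assignment P T,
        ∑ σ : Equiv.Perm (Fin (∑ i, (P i).m)) with Extends σ χ, interpolationWeight χ σ • f σ := by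
  have hσ (σ : Equiv.Perm (Fin (∑ i, (P i).m))) :
      (if (linkGraph (block P) σ).Connected then f σ else 0) =
        ∑ T : LabeledTree (n + 1), ∑ χ : Assignment P T,
          if Extends σ χ then interpolationWeight χ σ • f σ else 0 := by
    rw [← one_smul ℝ (f σ), ← ite_zero_smul, ← sum_trees_interpolationWeight]
    simp only [sum_smul, sum_filter, one_smul, ite_zero_smul]
  simp only [sum_filter, hσ]
  rw [sum_comm]
  exact sum_congr rfl fun T _ => sum_comm

end Interpolation

/-! ### Assembling the expansion -/

section Signs

open Finset

variable {Ω : Type*} {s : ℕ} {P : Fin s → Interaction Ω} {T : LabeledTree s}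

theorem val_pos (P : Fin s → Interaction Ω) (x : Leg P) :
    (pos P x : ℕ) = (∑ r ∈ Iio x.1, (P r).m) + (x.2 : ℕ) := by
  rw [pos, finSigmaFinEquiv_apply]
  congr 1
  refine sum_bij (fun i _ => Fin.castLE x.1.2.le i) (fun i _ => mem_Iio.2 (Fin.lt_def.2 i.2))
    (fun i _ j _ h => Fin.castLE_injective _ h) (fun r hr => ?_) fun i _ => rfl
  exact ⟨⟨r, Fin.lt_def.1 (mem_Iio.1 hr)⟩, mem_univ _, rfl⟩

theorem edgeSign_eq (χ : Assignment P T) (e : Edge T) :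
    edgeSign χ e = (-1) ^ ((row χ e : ℕ) + (col χ e : ℕ)) := by
  rw [row, col, edgeSign, annihLeg, creatLeg]
  split_ifs <;> rw [val_pos, val_pos] <;> exact congrArg _ (by ring)

theorem matchingSign_eq (χ : Assignment P T) {F : Type*} {ρ κ : Edge T ⊕ F ≃ Fin (∑ i, (P i).m)}
    (hρ : ∀ e, ρ (.inl e) = row χ e) (hκ : ∀ e, κ (.inl e) = col χ e) :
    matchingSign χ = ∏ e, ∏ e', inversionSign ρ κ (.inl e) (.inl e') := by
  simp only [inversionSign, hρ, hκ]
  rw [matchingSign, ← prod_product', ← prod_const, prod_filter]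
  rfl

theorem exists_equiv_extending_orderEmbOfFin {E : Type*} {N k : ℕ} {f : E → Fin N}
    (hf : Function.Injective f) {A : Finset (Fin N)} (hA : (A : Set (Fin N)) = (Set.range f)ᶜ)
    (hk : #A = k) : ∃ ρ : E ⊕ Fin k ≃ Fin N,
      (∀ e, ρ (.inl e) = f e) ∧ ρ ∘ Sum.inr = A.orderEmbOfFin hk := by
  refine ⟨.ofBijective (Sum.elim f (A.orderEmbOfFin hk)) ⟨?_, ?_⟩, fun _ => rfl, rfl⟩
  · refine hf.sumElim (OrderEmbedding.strictMono _).injective fun e a h => ?_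
    exact hA.subset (orderEmbOfFin_mem A hk a) ⟨e, h⟩
  · rw [← Set.range_eq_univ, Set.Sum.elim_range, range_orderEmbOfFin, hA, Set.union_compl_self]

open scoped Classical in
theorem edgeSign_mul_matchingSign_mul_det {R : Type*} [CommRing R] (χ : Assignment P T)
    (M : Matrix (Fin (∑ i, (P i).m)) (Fin (∑ i, (P i).m)) R) :
    (((∏ e, edgeSign χ e) * matchingSign χ : ℤˣ) : ℤ) * (M.submatrix
      ((freeRows χ).orderEmbOfFin rfl) ((freeCols χ).orderEmbOfFin (card_freeCols χ))).det =
    ∑ σ : Equiv.Perm (Fin (∑ i, (P i).m)) with Extends σ χ,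
      ((Equiv.Perm.sign σ : ℤ) : R) * ∏ x ∈ freeRows χ, M x (σ x) := by
  obtain ⟨ρ, hρ, hρfree⟩ := exists_equiv_extending_orderEmbOfFin (row_injective χ)
    (A := freeRows χ) (by simp [freeRows]) rfl
  obtain ⟨κ, hκ, hκfree⟩ := exists_equiv_extending_orderEmbOfFin (col_injective χ)
    (A := freeCols χ) (by simp [freeCols]) (card_freeCols χ)
  have hfree (σ : Equiv.Perm (Fin (∑ i, (P i).m))) :
      ∏ a, M (ρ (.inr a)) (σ (ρ (.inr a))) = ∏ x ∈ freeRows χ, M x (σ x) := by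
    refine (Fintype.prod_equiv ((freeRows χ).orderIsoOfFin rfl).toEquiv _ _ fun a => ?_).trans
      (prod_coe_sort (freeRows χ) fun x => M x (σ x))
    rw [show ρ (.inr a) = _ from congrFun hρfree a]
    rfl
  have hlaplace := sum_perm_extending M (ρ := ρ) (κ := κ)
    (by rw [hρfree]; exact OrderEmbedding.strictMono _)
    (by rw [hκfree]; exact OrderEmbedding.strictMono _)
  simp only [hfree, hρ, hκ, hρfree, hκfree] at hlaplace
  simp only [matchingSign_eq χ hρ hκ, edgeSign_eq]
  refine hlaplace.symm.trans (sum_congr ?_ fun _ _ => rfl)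
  ext σ
  rw [mem_filter, mem_filter, Extends]

end Signs

section Expansion

open Finset MeasureTheory

variable {Ω : Type*} [Fintype Ω] [LinearOrder Ω] {n : ℕ} {β : ℝ} {h : Matrix Ω Ω ℂ}
  {P : Fin (n + 1) → Interaction Ω} {τ : Fin (n + 1) → ℝ} {T : LabeledTree (n + 1)}

/-- The matrix of the Green's functions, with rows and columns numbered consecutively. -/
def numberedGreen (β : ℝ) (h : Matrix Ω Ω ℂ) (P : Fin (n + 1) → Interaction Ω)
    (τ : Fin (n + 1) → ℝ) : Matrix (Fin (∑ i, (P i).m)) (Fin (∑ i, (P i).m)) ℂ :=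
  (greenMatrix β h P τ).submatrix finSigmaFinEquiv.symm finSigmaFinEquiv.symm

theorem propagator_eq (χ : Assignment P T) (e : Edge T) :
    propagator β h τ χ e = numberedGreen β h P τ (row χ e) (col χ e) := by
  rw [numberedGreen, Matrix.submatrix_apply, row, col, pos, pos, Equiv.symm_apply_apply,
    Equiv.symm_apply_apply, annihLeg, creatLeg, propagator]
  split_ifs <;> rfl

theorem weightedGreen_apply (ω : Equiv.Perm (Fin (n + 1))) (t : Fin n → ℝ)
    (x y : Fin (∑ i, (P i).m)) :
    weightedGreen β h P τ ω t x y =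
      (weight ω t (block P x) (block P y) : ℂ) * numberedGreen β h P τ x y := rfl

open scoped Classical in
theorem cumulant_eq_sum_connected (hZ : partitionFunction β h ≠ 0) (hτ : Function.Injective τ) :
    cumulant β h P τ = (∏ i, ((interactionSign (P i) : ℤ) : ℂ)) *
      ∑ σ : Equiv.Perm (Fin (∑ i, (P i).m)) with (linkGraph (block P) σ).Connected,
        ((Equiv.Perm.sign σ : ℤ) : ℂ) * ∏ x, numberedGreen β h P τ x (σ x) := by
  have hdet (B : Finset (Fin (n + 1))) : correlation β h P τ B =
      (∏ i ∈ B, ((interactionSign (P i) : ℤ) : ℂ)) * ((numberedGreen β h P τ).submatrix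
        (Subtype.val : {x // block P x ∈ B} → _) Subtype.val).det := by
    let e : {x // block P x ∈ B} ≃ {x : Leg P // x.1 ∈ B} :=
      finSigmaFinEquiv.symm.subtypeEquiv fun x => Iff.rfl
    rw [correlation_eq_det hZ P hτ, ← Matrix.det_submatrix_equiv_self e]
    rfl
  have hsign (Q : Finpartition (univ : Finset (Fin (n + 1)))) :
      ∏ B ∈ Q.parts, ∏ i ∈ B, ((interactionSign (P i) : ℤ) : ℂ) =
        ∏ i, ((interactionSign (P i) : ℤ) : ℂ) := by
    conv_rhs => rw [← Q.biUnion_parts]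
    exact (prod_biUnion Q.disjoint).symm
  rw [cumulant, ← sum_partitions_prod_det_blocks, mul_sum]
  refine sum_congr rfl fun Q _ => ?_
  simp only [hdet, prod_mul_distrib, hsign]
  ring

theorem prod_propagator_mul_prod_freeRows {χ : Assignment P T}
    {σ : Equiv.Perm (Fin (∑ i, (P i).m))} (hσ : Extends σ χ) :
    (∏ e : Edge T, propagator β h τ χ e) * ∏ x ∈ freeRows χ, numberedGreen β h P τ x (σ x) =
      ∏ x, numberedGreen β h P τ x (σ x) := by
  have hedges : ∏ e : Edge T, propagator β h τ χ e =
      ∏ x ∈ univ.image (row χ), numberedGreen β h P τ x (σ x) := by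
    rw [prod_image fun _ _ _ _ hx => row_injective χ hx]
    exact prod_congr rfl fun e _ => by rw [hσ, propagator_eq]
  rw [hedges, freeRows, prod_mul_prod_compl]

theorem continuous_weight (ω : Equiv.Perm (Fin (n + 1))) (j k : Fin (n + 1)) :
    Continuous fun t => weight ω t j k := by
  unfold weight
  fun_prop

theorem continuous_pathDensity (ω : Equiv.Perm (Fin (n + 1))) : Continuous (pathDensity T ω) := by
  unfold pathDensity
  fun_prop

open scoped Classical in
theorem sign_mul_det_reducedGreen (χ : Assignment P T) (ω : Equiv.Perm (Fin (n + 1)))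
    (t : Fin n → ℝ) :
    (((∏ e, edgeSign χ e) * matchingSign χ : ℤˣ) : ℤ) *
        (∏ e : Edge T, propagator β h τ χ e) * (reducedGreen β h τ χ ω t).det =
      ∑ σ : Equiv.Perm (Fin (∑ i, (P i).m)) with Extends σ χ,
        ((Equiv.Perm.sign σ : ℤ) : ℂ) * (∏ x, numberedGreen β h P τ x (σ x)) *
          (∏ x ∈ freeRows χ, weight ω t (block P x) (block P (σ x)) : ℝ) := by
  rw [mul_right_comm, reducedGreen, edgeSign_mul_matchingSign_mul_det, sum_mul]
  refine sum_congr rfl fun σ hσ => ?_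
  simp only [weightedGreen_apply, prod_mul_distrib, Complex.ofReal_prod,
    ← prod_propagator_mul_prod_freeRows (mem_filter.1 hσ).2]
  ring

open scoped Classical in
theorem sign_mul_integral_reducedGreen (χ : Assignment P T) (ω : Equiv.Perm (Fin (n + 1))) :
    (((∏ e, edgeSign χ e) * matchingSign χ : ℤˣ) : ℤ) *
        (∏ e : Edge T, propagator β h τ χ e) *
        ∫ t in Set.Icc (0 : Fin n → ℝ) 1,
          (pathDensity T ω t : ℂ) * (reducedGreen β h τ χ ω t).det =
      ∑ σ : Equiv.Perm (Fin (∑ i, (P i).m)) with Extends σ χ,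
        ((Equiv.Perm.sign σ : ℤ) : ℂ) * (∏ x, numberedGreen β h P τ x (σ x)) *
          (∫ t in Set.Icc (0 : Fin n → ℝ) 1, pathDensity T ω t *
            ∏ x ∈ freeRows χ, weight ω t (block P x) (block P (σ x)) : ℝ) := by
  have hintegrable (σ : Equiv.Perm (Fin (∑ i, (P i).m))) (c : ℂ) :
      IntegrableOn (fun t : Fin n → ℝ =>
      c * ((pathDensity T ω t * ∏ x ∈ freeRows χ, weight ω t (block P x) (block P (σ x)) : ℝ) : ℂ))
        (Set.Icc 0 1) :=
    ContinuousOn.integrableOn_compact isCompact_Icc <| Continuous.continuousOn <|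
      continuous_const.mul <| Complex.continuous_ofReal.comp <|
        (continuous_pathDensity ω).mul <| continuous_finsetProd _ fun x _ => continuous_weight ω _ _
  simp only [← integral_complex_ofReal, ← integral_const_mul]
  rw [← integral_finsetSum _ fun σ _ => hintegrable σ _]
  refine integral_congr_ae (.of_forall fun t => ?_)
  beta_reduce
  rw [mul_left_comm, sign_mul_det_reducedGreen, mul_sum]
  refine sum_congr rfl fun σ _ => ?_
  push_cast
  ring

open scoped Classical in
theorem treeSign_mul_remainder (χ : Assignment P T) :
    ((treeSign χ : ℤ) : ℂ) * (∏ e : Edge T, propagator β h τ χ e) * remainder β h τ χ =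
      (∏ i, ((interactionSign (P i) : ℤ) : ℂ)) *
        ∑ σ : Equiv.Perm (Fin (∑ i, (P i).m)) with Extends σ χ, interpolationWeight χ σ •
          (((Equiv.Perm.sign σ : ℤ) : ℂ) * ∏ x, numberedGreen β h P τ x (σ x)) := by
  have hsign : ((treeSign χ : ℤ) : ℂ) = (∏ i, ((interactionSign (P i) : ℤ) : ℂ)) *
      ((((∏ e, edgeSign χ e) * matchingSign χ : ℤˣ) : ℤ) : ℂ) := by
    rw [treeSign, mul_assoc]
    push_cast
    rfl
  rw [hsign, remainder, mul_assoc, mul_assoc, ← mul_assoc (_ : ℂ) (∏ e : Edge T, _)]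
  congr 1
  rw [mul_sum, sum_congr rfl fun ω _ => sign_mul_integral_reducedGreen χ (Subtype.val ω), sum_comm]
  simp only [interpolationWeight, sum_smul, Complex.real_smul, mul_comm]

end Expansion

end TreeDet

end

open TreeDet in
theorem theorem4p6_general {Ω : Type*} [Fintype Ω] [LinearOrder Ω]
    (β : ℝ) (h : Matrix Ω Ω ℂ) (hZ : partitionFunction β h ≠ 0)
    (n : ℕ) (P : Fin (n + 1) → Interaction Ω)
    (τ : Fin (n + 1) → ℝ) (hτ : Function.Injective τ) :
    cumulant β h P τ =
      ∑ T : LabeledTree (n + 1), ∑ χ : Assignment P T,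
        ((treeSign χ : ℤ) : ℂ) * (∏ e : Edge T, propagator β h τ χ e) * remainder β h τ χ := by
  classical
  rw [cumulant_eq_sum_connected hZ hτ, sum_connected_eq_sum_trees]
  simp only [treeSign_mul_remainder, Finset.mul_sum]

open TreeDet in
theorem theorem4p6 {Ω : Type*} [Fintype Ω] [LinearOrder Ω]
    (β : ℝ) (h : Matrix Ω Ω ℂ) (hh : h.IsHermitian)
    (n : ℕ) (P : Fin (n + 1) → Interaction Ω)
    (τ : Fin (n + 1) → ℝ) (hτ : Function.Injective τ) :
    cumulant β h P τ =
      ∑ T : LabeledTree (n + 1), ∑ χ : Assignment P T,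
        ((treeSign χ : ℤ) : ℂ) * (∏ e : Edge T, propagator β h τ χ e) * remainder β h τ χ :=
  theorem4p6_general β h (partitionFunction_ne_zero β hh) n P τ hτ
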